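/- **Setting.** Let $\mathsf{Met}$ be the category of metric spaces and $1$-Lipschitz maps, and $\mathsf{tbMet}$ its full subcategory of totally bounded metric spaces. A morphism $f:X\to B$ in $\mathsf{Met}$ is a *submetry* if it is surjective and $d_H(f^{-1}(b_0),f^{-1}(b_1))\le d(b_0,b_1)$ for all $b_0,b_1\in B$, where $d_H$ is the Hausdorff distance; it is *proper* if it is a proper map. It is a *local submetry* if every $x\in X$ has an $r>0$ such that $f(B(x',s))=B(f(x'),s)$ whenever $d(x,x')<r$ and $0<s<r-d(x,x')$. An *lsm covering* of $X\in\mathsf{tbMet}$ is a family $\{f_i:U_i\to X\}$ of local submetries in $\mathsf{tbMet}$ such that for all $x_1,x_2,x_3\in X$ and $\varepsilon>0$ there are $i$ and $u_k\in f_i^{-1}(x_k)$ with $d(u_1,u_2)<d(x_1,x_2)+\varepsilon$ and $d(u_2,u_3)<d(x_2,x_3)+\varepsilon$. Lsm coverings make $\mathsf{tbMet}$ a site, and "stack" means stack in groupoids over this site. A metric space $U$ is regarded as the stack $T\mapsto \mathrm{Hom}_{\mathsf{Met}}(T,U)$. For $r>0$ let $2_r=\{0,r\}\subset\mathbb R$;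 write $\iota_{0r}:*\to 2_r$ for the map with value $0$ and, for $r>s>0$, $\iota_{rs}:2_r\to 2_s$ for the bijection fixing $0$. A morphism $f:\mathcal X\to\mathcal Y$ of stacks is a *formal submetry* if $\mathcal X(*)\to\mathcal Y(*)$ is essentially surjective and for all $r>s>0$, $x:*\to\mathcal X$, $g:2_s\to\mathcal Y$ and $\alpha:f\circ x\cong g\circ\iota_{0s}$ there are $h:2_r\to\mathcal X$, $\beta:h\circ\iota_{0r}\cong x$ and $\gamma:f\circ h\cong g\circ\iota_{rs}$ with $\alpha\circ(f\star\beta)=\gamma\star\iota_{0r}$. It is a *representable proper submetry* if for every $T\in\mathsf{tbMet}$ and every $b:T\to\mathcal Y$ there are a proper submetry $X_T\to T$ in $\mathsf{Met}$ and an equivalence $X_T\simeq\mathcal X\times_{\mathcal Y}T$ over $T$. A stack $\mathcal X$ is a *naive metric stack* if it admits a formal submetry $U\to\mathcal X$ from a metric space $U$; it is *of quotient type* if such a formal submetry can be chosen so that for every $T\in\mathsf{tbMet}$ and $t\in\mathcal X(T)$ there is an lsm covering $\{q_i:U_i\to T\}$ with every $q_i^*t$ in the essential image of $U(U_i)\to\mathcal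 X(U_i)$. For $n\ge 0$, $\mathcal{GH}_n$ is the category over $\mathsf{tbMet}$ whose objects over $T$ are the proper submetries $p:P\to T$ in $\mathsf{Met}$ with sections $s_1,\dots,s_n$ of $p$ in $\mathsf{Met}$, and whose morphisms are the Cartesian squares compatible with the sections. Let $p_n:\mathcal{GH}_{n+1}\to\mathcal{GH}_n$ forget the last section, and let $\sigma_i:\mathcal{GH}_n\to\mathcal{GH}_{n+1}$ ($1\le i\le n$) send $(p,(s_1,\dots,s_n))$ to $(p,(s_1,\dots,s_n,s_i))$. **Theorem.** 1. For every $n\ge 0$, the morphism $p_n:\mathcal{GH}_{n+1}\to\mathcal{GH}_n$ is a representable proper submetry. 2. For every $n\ge 0$, $\mathcal{GH}_n$ is a stack in groupoids over $\mathsf{tbMet}$ with the lsm topology, and it is a naive metric stack of quotient type. 3. Let $n\ge 0$, let $X$ be a totally bounded metric space, let $p:P\to X$ be a representable proper submetry from a stack in groupoids $P$, and let $s_1,\dots,s_n:X\to P$ be sections of $p$ (up to isomorphism). Then there are morphisms $[P]:X\to\mathcal{GH}_n$ and $[\Delta]:P\to\mathcal{GH}_{n+1}$ and $2$-isomorphisms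 $\sigma_i\circ[P]\cong[\Delta]\circ s_i$ for $1\le i\le n$ and $p_n\circ[\Delta]\cong[P]\circ p$ such that all the squares $$\begin{array}{ccc}X&\xrightarrow{\,s_i\,}&P\\ {\scriptstyle[P]}\downarrow&&\downarrow{\scriptstyle[\Delta]}\\ \mathcal{GH}_n&\xrightarrow{\,\sigma_i\,}&\mathcal{GH}_{n+1}\end{array}\qquad\qquad\begin{array}{ccc}P&\xrightarrow{\,p\,}&X\\ {\scriptstyle[\Delta]}\downarrow&&\downarrow{\scriptstyle[P]}\\ \mathcal{GH}_{n+1}&\xrightarrow{\,p_n\,}&\mathcal{GH}_n\end{array}$$ are $2$-Cartesian. -/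

import Mathlib

open CategoryTheory CategoryTheory.Functor

universe v w u

namespace MetStack

/-! ## Metric spaces and 1-Lipschitz maps -/

/-- (Small) metric spaces. -/
structure Met : Type (u + 1) where
  carrier : Type u
  [metric : MetricSpace carrier]

instance : CoeSort Met.{u} (Type u) := ⟨Met.carrier⟩

instance (X : Met.{u}) : MetricSpace X := X.metric

/-- A morphism of metric spaces is a 1-Lipschitz map. -/
@[ext]
structure Met.Hom (X Y : Met.{u}) : Type u where
  toFun : X → Y
  lipschitz : LipschitzWith 1 toFun

instance : Category.{u} Met.{u} where
  Hom := Met.Hom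
  id X := ⟨fun x => x, LipschitzWith.id⟩
  comp f g := ⟨fun x => g.toFun (f.toFun x), by
    have h := g.lipschitz.comp f.lipschitz
    rwa [mul_one] at h⟩

instance (X Y : Met.{u}) : CoeFun (X ⟶ Y) (fun _ => X → Y) := ⟨Met.Hom.toFun⟩

/-- The property of being totally bounded. -/
def IsTotBdd : ObjectProperty Met.{u} := fun X => TotallyBounded (Set.univ : Set X)

/-- The full subcategory of totally bounded metric spaces. -/
abbrev TBMet : Type (u + 1) := IsTotBdd.{u}.FullSubcategory

/-- The inclusion of totally bounded metric spaces into all metric spaces. -/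
abbrev incl : TBMet.{u} ⥤ Met.{u} := IsTotBdd.{u}.ι

/-- The one-point metric space. -/
def pt : TBMet.{u} where
  obj := ⟨PUnit⟩
  property := Set.finite_univ.totallyBounded

/-- The underlying set of the two-point metric spaces. -/
inductive TwoPt : Type u
  | zero
  | one

/-- The distance on two points which puts them at distance `r`. -/
def twoDist (r : ℝ) : TwoPt.{u} → TwoPt.{u} → ℝ
  | .zero, .zero => 0
  | .one, .one => 0
  | .zero, .one => r
  | .one, .zero => r

/-- The two-point metric space `2_r = {0, r}`, for `r > 0`. -/
def twoMet (r : ℝ) (hr : 0 < r) : Met.{u} where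
  carrier := TwoPt.{u}
  metric :=
    { dist := twoDist r
      dist_self := by rintro (_ | _) <;> rfl
      dist_comm := by rintro (_ | _) (_ | _) <;> rfl
      dist_triangle := by
        rintro (_ | _) (_ | _) (_ | _) <;> simp only [twoDist] <;> linarith
      eq_of_dist_eq_zero := by
        rintro (_ | _) (_ | _) h
        · rfl
        · exact absurd h hr.ne'
        · exact absurd h hr.ne'
        · rfl }

/-- The space `2_r` as a totally bounded metric space. -/
def two (r : ℝ) (hr : 0 < r) : TBMet.{u} where
  obj := twoMet r hr
  property := by
    have : Finite (twoMet.{u} r hr) :=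
      Finite.of_surjective (fun b : Bool => if b then TwoPt.one else TwoPt.zero) (by
        rintro (_ | _)
        · exact ⟨false, rfl⟩
        · exact ⟨true, rfl⟩)
    exact Set.finite_univ.totallyBounded

/-- The morphism `* → 2_r` with value `0`. -/
def iotaZero (r : ℝ) (hr : 0 < r) : pt.{u} ⟶ two.{u} r hr where
  hom := ⟨fun _ => TwoPt.zero, LipschitzWith.const' _⟩

/-- For `r ≥ s`, the bijective morphism `2_r → 2_s` sending `0` to `0`. -/
def iotaTwo (r s : ℝ) (hr : 0 < r) (hs : 0 < s) (h : s ≤ r) : two.{u} r hr ⟶ two.{u} s hs where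
  hom := ⟨fun x => x, LipschitzWith.of_dist_le_mul (by
    rintro (_ | _) (_ | _)
    · change (0 : ℝ) ≤ 1 * 0; simp
    · change s ≤ 1 * r; simpa using h
    · change s ≤ 1 * r; simpa using h
    · change (0 : ℝ) ≤ 1 * 0; simp)⟩

/-! ## Submetries, local submetries and lsm coverings -/

/-- `f` is a submetry: it is surjective, and the Hausdorff distance between the fibres over two
points is at most the distance between these points. -/
def IsSubmetry {X B : Met.{u}} (f : X ⟶ B) : Prop :=
  Function.Surjective f ∧
    ∀ b₀ b₁ : B, Metric.hausdorffEDist (f ⁻¹' {b₀}) (f ⁻¹' {b₁}) ≤ edist b₀ b₁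

/-- `f` is a proper submetry. -/
def IsProperSubmetry {X B : Met.{u}} (f : X ⟶ B) : Prop :=
  IsSubmetry f ∧ IsProperMap f

/-- `f` is a local submetry. -/
def IsLocalSubmetry {X Y : Met.{u}} (f : X ⟶ Y) : Prop :=
  ∀ x : X, ∃ r : ℝ, 0 < r ∧ ∀ x' ∈ Metric.ball x r, ∀ s : ℝ, 0 < s → s < r - dist x x' →
    f '' Metric.ball x' s = Metric.ball (f x') s

/-- `{f i : U i ⟶ X}` is an lsm covering of `X`. These are the covering families of the lsm site
of totally bounded metric spaces. -/
def IsLsmCovering {X : TBMet.{u}} {I : Type u} (U : I → TBMet.{u}) (f : ∀ i, U i ⟶ X) : Prop :=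
  (∀ i, IsLocalSubmetry (f i).hom) ∧
    ∀ (x₁ x₂ x₃ : X.obj) (ε : ℝ), 0 < ε → ∃ (i : I) (u₁ u₂ u₃ : (U i).obj),
      (f i).hom u₁ = x₁ ∧ (f i).hom u₂ = x₂ ∧ (f i).hom u₃ = x₃ ∧
      dist u₁ u₂ < dist x₁ x₂ + ε ∧ dist u₂ u₃ < dist x₂ x₃ + ε

/-! ## Categories over a base: fibres, 2-fibre products, equivalences

1-morphisms of categories over `C` are the functors strictly compatible with the projections,
and 2-morphisms are the natural transformations lying over identities; this is the bicategory
`BasedCategory C`. -/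

section Based

variable {C : Type w} [Category.{v} C]

/-- The functor induced by a morphism of categories over `C` between the fibres over `S`. -/
def fiberMap {𝒳 𝒴 : BasedCategory.{u, u + 1} C} (F : 𝒳 ⟶ 𝒴) (S : C) :
    Fiber 𝒳.p S ⥤ Fiber 𝒴.p S where
  obj x := ⟨F.obj x.1, (F.w_obj x.1).trans x.2⟩
  map {x y} φ := ⟨F.map φ.1, by
    have := φ.2
    exact BasedFunctor.preserves_isHomLift F (𝟙 S) φ.1⟩
  map_id x := Subtype.ext (F.map_id x.1)
  map_comp φ ψ := Subtype.ext (F.map_comp φ.1 ψ.1)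

/-- `F` is an equivalence of categories over `C`: it has a quasi-inverse over `C`. -/
def IsBasedEquivalence {𝒳 𝒴 : BasedCategory.{u, u + 1} C} (F : 𝒳 ⟶ 𝒴) : Prop :=
  ∃ G : 𝒴 ⟶ 𝒳, Nonempty (F ≫ G ≅ 𝟙 𝒳) ∧ Nonempty (G ≫ F ≅ 𝟙 𝒴)

/-- `𝒳` is fibred in groupoids over `C`. -/
def IsFiberedInGroupoids (𝒳 : BasedCategory.{u, u + 1} C) : Prop :=
  𝒳.p.IsFibered ∧ ∀ S : C, IsGroupoid (Fiber 𝒳.p S)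

variable {𝒲 𝒳 𝒴 𝒵 : BasedCategory.{u, u + 1} C}

/-- An object of the 2-fibre product of `f : 𝒳 ⟶ 𝒵` and `g : 𝒴 ⟶ 𝒵`: an object of `𝒳` and an
object of `𝒴` over the same object of `C`, with an isomorphism in the fibre between their images
in `𝒵`. -/
structure TwoFib (f : 𝒳 ⟶ 𝒵) (g : 𝒴 ⟶ 𝒵) : Type (u + 1) where
  fst : 𝒳.obj
  snd : 𝒴.obj
  base_eq : 𝒴.p.obj snd = 𝒳.p.obj fst
  iso : f.obj fst ≅ g.obj snd
  iso_lift : 𝒵.p.IsHomLift (𝟙 (𝒳.p.obj fst)) iso.hom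

/-- A morphism of the 2-fibre product: a pair of morphisms over the same morphism of `C`,
compatible with the given isomorphisms. -/
@[ext]
structure TwoFib.Hom {f : 𝒳 ⟶ 𝒵} {g : 𝒴 ⟶ 𝒵} (a b : TwoFib f g) : Type u where
  fst : a.fst ⟶ b.fst
  snd : a.snd ⟶ b.snd
  lift : 𝒴.p.IsHomLift (𝒳.p.map fst) snd
  comm : f.map fst ≫ b.iso.hom = a.iso.hom ≫ g.map snd

instance (f : 𝒳 ⟶ 𝒵) (g : 𝒴 ⟶ 𝒵) : Category.{u} (TwoFib f g) where
  Hom := TwoFib.Hom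
  id a :=
    { fst := 𝟙 _
      snd := 𝟙 _
      lift := by
        rw [𝒳.p.map_id]
        exact IsHomLift.id a.base_eq
      comm := by simp }
  comp {a b c} φ ψ :=
    { fst := φ.fst ≫ ψ.fst
      snd := φ.snd ≫ ψ.snd
      lift := by
        have := φ.lift
        have := ψ.lift
        rw [𝒳.p.map_comp]
        infer_instance
      comm := by
        rw [Functor.map_comp, Functor.map_comp, Category.assoc, ψ.comm, ← Category.assoc, φ.comm,
          Category.assoc] }
  id_comp φ := TwoFib.Hom.ext (Category.id_comp _) (Category.id_comp _)
  comp_id φ := TwoFib.Hom.ext (Category.comp_id _) (Category.comp_id _)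
  assoc φ ψ χ := TwoFib.Hom.ext (Category.assoc _ _ _) (Category.assoc _ _ _)

/-- The projection of the 2-fibre product to the base category. -/
def TwoFib.toBase (f : 𝒳 ⟶ 𝒵) (g : 𝒴 ⟶ 𝒵) : TwoFib f g ⥤ C where
  obj a := 𝒳.p.obj a.fst
  map {a b} (φ : TwoFib.Hom a b) := 𝒳.p.map φ.fst
  map_id a := 𝒳.p.map_id a.fst
  map_comp {a b c} (φ : TwoFib.Hom a b) (ψ : TwoFib.Hom b c) := 𝒳.p.map_comp φ.fst ψ.fst

/-- The 2-fibre product `𝒳 ×_𝒵 𝒴`, as a category over `C`. -/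
def twoFib (f : 𝒳 ⟶ 𝒵) (g : 𝒴 ⟶ 𝒵) : BasedCategory.{u, u + 1} C :=
  BasedCategory.ofFunctor (TwoFib.toBase f g)

/-- The projection `𝒳 ×_𝒵 𝒴 → 𝒴`. -/
def twoFibSnd (f : 𝒳 ⟶ 𝒵) (g : 𝒴 ⟶ 𝒵) : twoFib f g ⟶ 𝒴 where
  obj := fun (a : TwoFib f g) => a.snd
  map := fun {a b : TwoFib f g} (φ : TwoFib.Hom a b) => φ.snd
  map_id := fun _ => rfl
  map_comp := fun _ _ => rfl
  w := by
    refine CategoryTheory.Functor.ext (fun a : TwoFib f g => a.base_eq)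
      (fun (a b : TwoFib f g) (φ : TwoFib.Hom a b) => ?_)
    have := φ.lift
    exact IsHomLift.fac' 𝒴.p (𝒳.p.map φ.fst) φ.snd

/-- The morphism to the 2-fibre product induced by a 2-commutative square. -/
def twoFibLift {f : 𝒳 ⟶ 𝒵} {g : 𝒴 ⟶ 𝒵} {F : 𝒲 ⟶ 𝒳} {G : 𝒲 ⟶ 𝒴} (α : F ≫ f ≅ G ≫ g) :
    𝒲 ⟶ twoFib f g where
  obj := fun a => show TwoFib f g from
    { fst := F.obj a
      snd := G.obj a
      base_eq := (G.w_obj a).trans (F.w_obj a).symm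
      iso := ⟨α.hom.app a, α.inv.app a,
        congr_arg (fun β => β.toNatTrans.app a) α.hom_inv_id,
        congr_arg (fun β => β.toNatTrans.app a) α.inv_hom_id⟩
      iso_lift := α.hom.isHomLift (F.w_obj a).symm }
  map := fun {a b} φ =>
    { fst := F.map φ
      snd := G.map φ
      lift := by
        have h : 𝒳.p.IsHomLift (𝒲.p.map φ) (F.map φ) := inferInstance
        have h' : 𝒴.p.IsHomLift (𝒲.p.map φ) (G.map φ) := inferInstance
        rw [IsHomLift.fac' 𝒳.p (𝒲.p.map φ) (F.map φ)]
        infer_instance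
      comm := α.hom.naturality φ }
  map_id := fun a => TwoFib.Hom.ext (F.map_id a) (G.map_id a)
  map_comp := fun φ ψ => TwoFib.Hom.ext (F.map_comp φ ψ) (G.map_comp φ ψ)
  w := F.w

/-- The 2-commutative square given by `α` is 2-Cartesian. -/
def IsTwoCartesian {f : 𝒳 ⟶ 𝒵} {g : 𝒴 ⟶ 𝒵} {F : 𝒲 ⟶ 𝒳} {G : 𝒲 ⟶ 𝒴} (α : F ≫ f ≅ G ≫ g) :
    Prop :=
  IsBasedEquivalence (twoFibLift α)

end Based

/-! ## Stacks in groupoids over the lsm site -/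

/-- The presheaf `Isom(x, y)` satisfies the sheaf condition for the family `f : U i ⟶ X`.
In a category fibred in groupoids, a section of `Isom(x, y)` over `g : V ⟶ X` is the same as a
natural way to turn morphisms `z ⟶ x` lying over maps that factor through `g` into morphisms
`z ⟶ y` over the same maps; so a compatible family of sections over the `U i` is a family `φ` as
below. -/
def IsomIsSheafFor (𝒳 : BasedCategory.{u, u + 1} TBMet.{u}) {X : TBMet.{u}} {I : Type u}
    (U : I → TBMet.{u}) (f : ∀ i, U i ⟶ X) : Prop :=
  ∀ (x y : Fiber 𝒳.p X)
    (φ : ∀ (z : 𝒳.obj) (g : 𝒳.p.obj z ⟶ X) (a : z ⟶ x.1), 𝒳.p.IsHomLift g a →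
      Sieve.ofArrows U f g → (z ⟶ y.1)),
    (∀ z g a ha hg, 𝒳.p.IsHomLift g (φ z g a ha hg)) →
    (∀ z z' (c : z' ⟶ z) g a ha hg g' ha' hg',
      φ z' g' (c ≫ a) ha' hg' = c ≫ φ z g a ha hg) →
    ∃! ψ : x ⟶ y, ∀ z g a ha hg, φ z g a ha hg = a ≫ ψ.1

/-- A descent datum for the family `f : U i ⟶ X`: objects `x i` over `U i` and gluing isomorphisms
`b₁^* x_i ≅ b₂^* x_j` for all `b₁ : V ⟶ U i`, `b₂ : V ⟶ U j` with the same composite to `X`,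
compatible with pull-back and satisfying the cocycle condition. The gluing isomorphism is encoded,
independently of the choice of pull-backs, by the operation `glue`, which turns a morphism
`z ⟶ x i` over `b₁` into the corresponding morphism `z ⟶ x j` over `b₂`. -/
structure DescentDatum (𝒳 : BasedCategory.{u, u + 1} TBMet.{u}) {X : TBMet.{u}} {I : Type u}
    (U : I → TBMet.{u}) (f : ∀ i, U i ⟶ X) : Type (u + 1) where
  x : ∀ i, Fiber 𝒳.p (U i)
  glue : ∀ (i j : I) (z : 𝒳.obj) (b₁ : 𝒳.p.obj z ⟶ U i) (b₂ : 𝒳.p.obj z ⟶ U j),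
    b₁ ≫ f i = b₂ ≫ f j → ∀ a : z ⟶ (x i).1, 𝒳.p.IsHomLift b₁ a → (z ⟶ (x j).1)
  glue_lift : ∀ i j z b₁ b₂ h a ha, 𝒳.p.IsHomLift b₂ (glue i j z b₁ b₂ h a ha)
  glue_comp : ∀ i j z z' (c : z' ⟶ z) b₁ b₂ h a ha h' ha',
    glue i j z' (𝒳.p.map c ≫ b₁) (𝒳.p.map c ≫ b₂) h' (c ≫ a) ha' = c ≫ glue i j z b₁ b₂ h a ha
  cocycle : ∀ i j k z b₁ b₂ b₃ h₁₂ h₂₃ h₁₃ a ha,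
    glue j k z b₂ b₃ h₂₃ (glue i j z b₁ b₂ h₁₂ a ha) (glue_lift i j z b₁ b₂ h₁₂ a ha) =
      glue i k z b₁ b₃ h₁₃ a ha

/-- A descent datum is effective: it is isomorphic to the one given by the pull-backs of an
object `y` over `X`. -/
def DescentDatum.IsEffective {𝒳 : BasedCategory.{u, u + 1} TBMet.{u}} {X : TBMet.{u}}
    {I : Type u} {U : I → TBMet.{u}} {f : ∀ i, U i ⟶ X} (D : DescentDatum 𝒳 U f) : Prop :=
  ∃ (y : Fiber 𝒳.p X) (ψ : ∀ i, (D.x i).1 ⟶ y.1),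
    (∀ i, 𝒳.p.IsHomLift (f i) (ψ i)) ∧
    ∀ i j z b₁ b₂ h a ha, D.glue i j z b₁ b₂ h a ha ≫ ψ j = a ≫ ψ i

/-- `𝒳` is a stack in groupoids over the lsm site: it is fibred in groupoids, the presheaves
`Isom(x, y)` are sheaves, and descent data for lsm coverings are effective. -/
def IsStackInGroupoids (𝒳 : BasedCategory.{u, u + 1} TBMet.{u}) : Prop :=
  IsFiberedInGroupoids 𝒳 ∧
    ∀ (X : TBMet.{u}) (I : Type u) (U : I → TBMet.{u}) (f : ∀ i, U i ⟶ X), IsLsmCovering U f →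
      IsomIsSheafFor 𝒳 U f ∧ ∀ D : DescentDatum 𝒳 U f, D.IsEffective

/-- The category over totally bounded metric spaces associated with a metric space `U`: its objects
over `T` are the 1-Lipschitz maps `T → U`. -/
def ofMet (U : Met.{u}) : BasedCategory.{u, u + 1} TBMet.{u} :=
  BasedCategory.ofFunctor (CostructuredArrow.proj incl.{u} U)

/-- The morphism `ofMet U ⟶ ofMet V` induced by a 1-Lipschitz map `U → V`. -/
def ofMetMap {U V : Met.{u}} (f : U ⟶ V) : ofMet U ⟶ ofMet V where
  toFunctor := CostructuredArrow.map f
  w := rfl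

/-! ## Naive metric stacks of quotient type -/

/-- `f` is a formal submetry: `𝒳(*) → 𝒴(*)` is essentially surjective, and for all `r > s > 0`,
every 2-commutative square `α` from `* → 2_s` to `f` lifts, along `2_r → 2_s`, to `h : 2_r → 𝒳`. -/
def IsFormalSubmetry {𝒳 𝒴 : BasedCategory.{u, u + 1} TBMet.{u}} (f : 𝒳 ⟶ 𝒴) : Prop :=
  (fiberMap f pt).EssSurj ∧
    ∀ (r s : ℝ) (hs : 0 < s) (hrs : s < r)
      (x : ofMet pt.obj ⟶ 𝒳) (g : ofMet (two s hs).obj ⟶ 𝒴)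
      (α : x ≫ f ≅ ofMetMap (iotaZero s hs).hom ≫ g),
      ∃ (h : ofMet (two r (hs.trans hrs)).obj ⟶ 𝒳)
        (β : ofMetMap (iotaZero r (hs.trans hrs)).hom ≫ h ≅ x)
        (γ : h ≫ f ≅ ofMetMap (iotaTwo r s (hs.trans hrs) hs hrs.le).hom ≫ g),
        BasedCategory.whiskerRight β.hom f ≫ α.hom =
          BasedCategory.whiskerLeft (ofMetMap (iotaZero r (hs.trans hrs)).hom) γ.hom

/-- `𝒳` is a naive metric stack: a stack in groupoids that admits a formal submetry from a metric
space. -/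
def IsNaiveMetricStack (𝒳 : BasedCategory.{u, u + 1} TBMet.{u}) : Prop :=
  IsStackInGroupoids 𝒳 ∧ ∃ (U : Met.{u}) (p : ofMet U ⟶ 𝒳), IsFormalSubmetry p

/-- The naive metric stack `𝒳` is of quotient type: it admits a formal submetry from a metric
space `U` such that every object `t` over `T` lies, after pull-back to the members of some lsm
covering of `T`, in the essential image of `U`. -/
def IsOfQuotientType (𝒳 : BasedCategory.{u, u + 1} TBMet.{u}) : Prop :=
  ∃ (U : Met.{u}) (p : ofMet U ⟶ 𝒳), IsFormalSubmetry p ∧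
    ∀ (T : TBMet.{u}) (t : Fiber 𝒳.p T),
      ∃ (I : Type u) (V : I → TBMet.{u}) (q : ∀ i, V i ⟶ T), IsLsmCovering V q ∧
        ∀ i, ∃ (t' : Fiber 𝒳.p (V i)) (φ : t'.1 ⟶ t.1), 𝒳.p.IsCartesian (q i) φ ∧
          (fiberMap p (V i)).essImage t'

/-- `f` is a representable proper submetry: for every totally bounded metric space `T` and every
morphism `b` from `T` to the target, the 2-fibre product over `T` is equivalent, over `T`, to a
metric space which is a proper submetry over `T`. -/
def IsRepresentableProperSubmetry {𝒳 ℬ : BasedCategory.{u, u + 1} TBMet.{u}} (f : 𝒳 ⟶ ℬ) : Prop :=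
  ∀ (T : TBMet.{u}) (b : ofMet T.obj ⟶ ℬ),
    ∃ (XT : Met.{u}) (fT : XT ⟶ T.obj) (e : ofMet XT ⟶ twoFib f b),
      IsProperSubmetry fT ∧ IsBasedEquivalence e ∧ Nonempty (e ≫ twoFibSnd f b ≅ ofMetMap fT)

/-! ## The moduli stacks of pointed compact metric spaces -/

/-- An object of `GH_n`: a proper submetry `p : P → T` to a totally bounded metric space, with
`n` sections. -/
structure GHObj (n : ℕ) : Type (u + 1) where
  T : TBMet.{u}
  P : Met.{u}
  p : P ⟶ T.obj
  proper : IsProperSubmetry p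
  s : Fin n → (T.obj ⟶ P)
  s_p : ∀ i, s i ≫ p = 𝟙 T.obj

/-- A morphism of `GH_n`: a Cartesian square compatible with the sections. -/
@[ext]
structure GHObj.Hom {n : ℕ} (A B : GHObj.{u} n) : Type u where
  tot : A.P ⟶ B.P
  base : A.T ⟶ B.T
  isPullback : IsPullback tot A.p B.p base.hom
  s_tot : ∀ i, A.s i ≫ tot = base.hom ≫ B.s i

instance (n : ℕ) : Category.{u} (GHObj.{u} n) where
  Hom := GHObj.Hom
  id A :=
    { tot := 𝟙 _
      base := 𝟙 _
      isPullback := IsPullback.of_id_fst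
      s_tot := fun _ => rfl }
  comp {A B C} φ ψ :=
    { tot := φ.tot ≫ ψ.tot
      base := φ.base ≫ ψ.base
      isPullback := φ.isPullback.paste_horiz ψ.isPullback
      s_tot := fun i => by
        rw [← Category.assoc, φ.s_tot, Category.assoc, ψ.s_tot]
        rfl }
  id_comp _ := rfl
  comp_id _ := rfl
  assoc _ _ _ := rfl

/-- The functor `(p : P → T, (s_i)) ↦ T`. -/
def GHObj.toBase (n : ℕ) : GHObj.{u} n ⥤ TBMet.{u} where
  obj A := A.T
  map {A B} (φ : GHObj.Hom A B) := φ.base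

/-- `GH_n`, as a category over totally bounded metric spaces. -/
def GH (n : ℕ) : BasedCategory.{u, u + 1} TBMet.{u} :=
  BasedCategory.ofFunctor (GHObj.toBase.{u} n)

/-- Forget the last section. -/
def GHObj.forgetLast (n : ℕ) : GHObj.{u} (n + 1) ⥤ GHObj.{u} n where
  obj A := ⟨A.T, A.P, A.p, A.proper, fun i => A.s i.castSucc, fun i => A.s_p i.castSucc⟩
  map {A B} (φ : GHObj.Hom A B) :=
    GHObj.Hom.mk φ.tot φ.base φ.isPullback fun i => φ.s_tot i.castSucc

/-- Repeat the `i`-th section: `(p, (s_1, …, s_n)) ↦ (p, (s_1, …, s_n, s_i))`. -/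
def GHObj.repeatSection (n : ℕ) (i : Fin n) : GHObj.{u} n ⥤ GHObj.{u} (n + 1) where
  obj A := ⟨A.T, A.P, A.p, A.proper, Fin.snoc (α := fun _ => A.T.obj ⟶ A.P) A.s (A.s i),
    Fin.lastCases (by simpa using A.s_p i) (fun j => by simpa using A.s_p j)⟩
  map {A B} (φ : GHObj.Hom A B) := GHObj.Hom.mk φ.tot φ.base φ.isPullback
    (Fin.lastCases (by simpa using φ.s_tot i) (fun j => by simpa using φ.s_tot j))

/-- The morphism `GH_{n+1} → GH_n` forgetting the last section. -/
def forgetLast (n : ℕ) : GH.{u} (n + 1) ⟶ GH.{u} n where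
  toFunctor := GHObj.forgetLast n
  w := rfl

/-- The morphism `GH_n → GH_{n+1}` repeating the `i`-th section. -/
def repeatSection (n : ℕ) (i : Fin n) : GH.{u} n ⟶ GH.{u} (n + 1) where
  toFunctor := GHObj.repeatSection n i
  w := rfl

end MetStack

open MetStack

namespace MetStack

/-! ## Pullbacks of metric spaces -/

/-! A square of metric spaces is Cartesian when it is so on points and the distance upstairs is at
most the maximum of the two projected distances. Hence morphisms of `GH n` can be built and compared
on points of total spaces, working with families (`Fam`) and Cartesian squares between them
(`Fam.IsCart`).

Descent. For families over a covering, the glued space consists of the points of the local total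
spaces modulo transport, and its distance is the infimum of the distances of representatives over
all charts. Transport changes distances only up to the distance in the base (`val_le_max`). Lifting
pairs with almost no loss therefore computes the infimum, and lifting triples gives the triangle
inequality. Morphisms are glued by the same estimate.

Squares. For a family `A`, completing a pullback of `A` to an object of `GH (n + 1)` means choosing
one more section, that is, a map to the total space `A.P`. So the pullback of `forgetLast n` along
the classifying morphism of `A` is `A.P`, with the diagonal of `A.diag` as universal section. This
proves the first statement and, once a representable family is replaced by a metric space
(`exists_val`), also the third.

Atlas. The space `Moduli n` consists of compact subsets of a large sup-normed space, with `n` marked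
points and the Hausdorff metric. An isometric embedding of a total space sends each base point to
the image of its fibre, and the submetry condition makes this map 1-Lipschitz. For a formal
submetry, a given embedding of one fibre must extend to the whole total space. This is why only rich
subsets are admitted: richness leaves enough coordinates to separate new points, and it is preserved
by restriction (`IsRich.comp`) and by extension (`IsRich.exists_extend`). -/

lemma Met.hom_ext {X Y : Met.{u}} {f g : X ⟶ Y} (h : ∀ x, f x = g x) : f = g :=
  Met.Hom.ext (funext h)

lemma Met.dist_map_le {X Y : Met.{u}} (f : X ⟶ Y) (x y : X) : dist (f x) (f y) ≤ dist x y := by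
  simpa using f.lipschitz.dist_le_mul x y

lemma Met.continuous {X Y : Met.{u}} (f : X ⟶ Y) : Continuous f := f.lipschitz.continuous

/-- Constructor for morphisms of metric spaces. -/
def Met.mkHom {X Y : Met.{u}} (f : X → Y) (h : ∀ x y, dist (f x) (f y) ≤ dist x y) : X ⟶ Y :=
  ⟨f, LipschitzWith.of_dist_le_mul (by simpa using h)⟩

@[simp]
lemma Met.mkHom_apply {X Y : Met.{u}} (f : X → Y) (h : ∀ x y, dist (f x) (f y) ≤ dist x y)
    (x : X) : Met.mkHom f h x = f x := rfl

@[simp]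
lemma Met.comp_apply {X Y Z : Met.{u}} (f : X ⟶ Y) (g : Y ⟶ Z) (x : X) : (f ≫ g) x = g (f x) := rfl

lemma Met.congr {X Y : Met.{u}} {f g : X ⟶ Y} (h : f = g) (x : X) : f x = g x := by rw [h]

/-- The fibre product of metric spaces, with the supremum metric. -/
def Met.pb {X Y Z : Met.{u}} (f : X ⟶ Z) (g : Y ⟶ Z) : Met.{u} := ⟨{p : X × Y // f p.1 = g p.2}⟩

lemma Met.pb_dist {X Y Z : Met.{u}} {f : X ⟶ Z} {g : Y ⟶ Z} (p q : Met.pb f g) :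
    dist p q = max (dist p.1.1 q.1.1) (dist p.1.2 q.1.2) := rfl

/-- The first projection of the fibre product. -/
def Met.pbFst {X Y Z : Met.{u}} (f : X ⟶ Z) (g : Y ⟶ Z) : Met.pb f g ⟶ X :=
  Met.mkHom (fun p => p.1.1) (fun p q => (le_max_left _ _).trans (Met.pb_dist p q).ge)

/-- The second projection of the fibre product. -/
def Met.pbSnd {X Y Z : Met.{u}} (f : X ⟶ Z) (g : Y ⟶ Z) : Met.pb f g ⟶ Y :=
  Met.mkHom (fun p => p.1.2) (fun p q => (le_max_right _ _).trans (Met.pb_dist p q).ge)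

/-- The distance bound is used twice: it makes the pointwise chosen lift 1-Lipschitz, and it forces
uniqueness, since points with equal projections are at distance zero. -/
theorem Met.isPullback_of {W X Y Z : Met.{u}} {a : W ⟶ X} {b : W ⟶ Y} {f : X ⟶ Z} {g : Y ⟶ Z}
    (comm : ∀ x, f (a x) = g (b x))
    (hd : ∀ x y, dist x y ≤ max (dist (a x) (a y)) (dist (b x) (b y)))
    (hs : ∀ x y, f x = g y → ∃ w, a w = x ∧ b w = y) : IsPullback a b f g := by
  refine ⟨⟨Met.hom_ext comm⟩, ⟨Limits.PullbackCone.IsLimit.mk _ (fun c => Met.mkHom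
    (fun x => (hs (c.fst x) (c.snd x) (Met.congr c.condition x)).choose) ?_) ?_ ?_ ?_⟩⟩
  · intro x y
    refine (hd _ _).trans ?_
    rw [(hs _ _ (Met.congr c.condition x)).choose_spec.1,
      (hs _ _ (Met.congr c.condition x)).choose_spec.2,
      (hs _ _ (Met.congr c.condition y)).choose_spec.1,
      (hs _ _ (Met.congr c.condition y)).choose_spec.2]
    exact max_le (Met.dist_map_le _ _ _) (Met.dist_map_le _ _ _)
  · intro c
    exact Met.hom_ext fun x => (hs _ _ (Met.congr c.condition x)).choose_spec.1
  · intro c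
    exact Met.hom_ext fun x => (hs _ _ (Met.congr c.condition x)).choose_spec.2
  · intro c m h₁ h₂
    refine Met.hom_ext fun x => dist_le_zero.1 ((hd _ _).trans ?_)
    have e₁ := Met.congr h₁ x
    have e₂ := Met.congr h₂ x
    simp only [Met.comp_apply] at e₁ e₂
    rw [e₁, e₂, Met.mkHom_apply, (hs _ _ (Met.congr c.condition x)).choose_spec.1,
      (hs _ _ (Met.congr c.condition x)).choose_spec.2]
    simp

/-- Comparison with the explicit fibre product: the canonical map `k` to it has the 1-Lipschitz left
inverse `l`, so distances in `W` are bounded by the supremum metric. -/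
theorem Met.exists_of_isPullback {W X Y Z : Met.{u}} {a : W ⟶ X} {b : W ⟶ Y} {f : X ⟶ Z}
    {g : Y ⟶ Z} (h : IsPullback a b f g) :
    (∀ x y, dist x y ≤ max (dist (a x) (a y)) (dist (b x) (b y))) ∧
      ∀ x y, f x = g y → ∃ w, a w = x ∧ b w = y := by
  let l : Met.pb f g ⟶ W := h.lift (Met.pbFst f g) (Met.pbSnd f g) (Met.hom_ext fun p => p.2)
  have l₁ : l ≫ a = Met.pbFst f g := h.lift_fst _ _ _
  have l₂ : l ≫ b = Met.pbSnd f g := h.lift_snd _ _ _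
  let k : W ⟶ Met.pb f g := Met.mkHom (fun x => ⟨(a x, b x), Met.congr h.w x⟩) fun x y =>
    max_le (Met.dist_map_le _ _ _) (Met.dist_map_le _ _ _)
  have hk : k ≫ l = 𝟙 W := by
    apply h.hom_ext
    · rw [Category.assoc, l₁]; rfl
    · rw [Category.assoc, l₂]; rfl
  refine ⟨fun x y => ?_, fun x y e => ⟨l ⟨(x, y), e⟩, Met.congr l₁ _, Met.congr l₂ _⟩⟩
  have := Met.dist_map_le l (k x) (k y)
  rw [← Met.comp_apply, ← Met.comp_apply, hk] at this
  exact this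

/-! ## Proper submetries -/

section Proper

variable {X B : Met.{u}} {f : X ⟶ B}

lemma IsProperSubmetry.isCompact_fiber (h : IsProperSubmetry f) (b : B) :
    IsCompact (f ⁻¹' {b}) :=
  h.2.isCompact_preimage isCompact_singleton

/-- The compact fibre over `b` attains its distance to `x`, so lifting holds without an error term.
-/
lemma IsProperSubmetry.exists_lift (h : IsProperSubmetry f) (x : X) (b : B) :
    ∃ x', f x' = b ∧ dist x x' ≤ dist (f x) b := by
  obtain ⟨y, hy⟩ := h.1.1 b
  obtain ⟨x', hx', e⟩ := (h.isCompact_fiber b).exists_infEDist_eq_edist ⟨y, hy⟩ x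
  refine ⟨x', hx', ?_⟩
  have h₁ : edist x x' ≤ edist (f x) b := by
    rw [← e]
    exact (Metric.infEDist_le_hausdorffEDist_of_mem (show x ∈ f ⁻¹' {f x} from rfl)).trans
      (h.1.2 (f x) b)
  rw [edist_dist, edist_dist] at h₁
  exact (ENNReal.ofReal_le_ofReal_iff dist_nonneg).1 h₁

/-- Approximate lifts suffice, because compact fibres attain distances and ε can be dropped. Exact
lifts in both directions bound the Hausdorff distance; given compact fibres, properness reduces to
closedness. -/
theorem isProperSubmetry_of (hs : Function.Surjective f) (hc : ∀ b, IsCompact (f ⁻¹' {b}))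
    (hl : ∀ (x : X) (b : B) (ε : ℝ), 0 < ε → ∃ x', f x' = b ∧ dist x x' ≤ dist (f x) b + ε) :
    IsProperSubmetry f := by
  have hl' : ∀ (x : X) (b : B), ∃ x', f x' = b ∧ dist x x' ≤ dist (f x) b := by
    intro x b
    obtain ⟨y, hy⟩ := hs b
    obtain ⟨x', hx', e⟩ := (hc b).exists_infDist_eq_dist ⟨y, hy⟩ x
    refine ⟨x', hx', ?_⟩
    rw [← e]
    refine le_of_forall_pos_le_add fun ε hε => ?_
    obtain ⟨z, hz, hz'⟩ := hl x b ε hε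
    exact (Metric.infDist_le_dist_of_mem (show z ∈ f ⁻¹' {b} from hz)).trans hz'
  have hl'' : ∀ (b b' : B) (x), f x = b → ∃ x' ∈ f ⁻¹' {b'}, edist x x' ≤ edist b b' := by
    rintro _ b' x rfl
    obtain ⟨x', h₁, h₂⟩ := hl' x b'
    exact ⟨x', h₁, by rw [edist_dist, edist_dist]; exact ENNReal.ofReal_le_ofReal h₂⟩
  refine ⟨⟨hs, fun b₀ b₁ => Metric.hausdorffEDist_le_of_mem_edist (fun x hx => hl'' b₀ b₁ x hx)
    fun x hx => ?_⟩, ?_⟩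
  · rw [edist_comm b₀ b₁]
    exact hl'' b₁ b₀ x hx
  · refine isProperMap_iff_isClosedMap_and_compact_fibers.2 ⟨Met.continuous f, ?_, fun b => hc b⟩
    intro A hA
    refine IsSeqClosed.isClosed ?_
    intro b b₀ hb hlim
    choose a ha ha' using hb
    -- Each `a n` is moved into the compact fibre over `b₀`, by a distance of at most `dist (b n)
    -- b₀`, which tends to zero. A subsequential limit of the moved points is thus a limit of points
    -- of `A`.
    choose a' h₁ h₂ using fun n => hl' (a n) b₀
    obtain ⟨a₀, ha₀, φ, hφ, hφ'⟩ := (hc b₀).tendsto_subseq h₁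
    refine ⟨a₀, hA.mem_of_tendsto (f := a ∘ φ) (b := Filter.atTop) ?_
      (Filter.Eventually.of_forall fun n => ha (φ n)), ha₀⟩
    refine (tendsto_iff_of_dist ?_).2 hφ'
    refine squeeze_zero (fun _ => dist_nonneg) (fun n => h₂ (φ n)) ?_
    have := (tendsto_iff_dist_tendsto_zero.1 hlim).comp hφ.tendsto_atTop
    simpa [Function.comp_def, ha'] using this

/-- Proper submetries are stable under base change. -/
theorem IsProperSubmetry.of_cartesian (h : IsProperSubmetry f) {X' B' : Met.{u}} {f' : X' ⟶ B'}
    {t : X' ⟶ X} {g : B' ⟶ B}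
    (hd : ∀ x y, dist x y ≤ max (dist (t x) (t y)) (dist (f' x) (f' y)))
    (comm : ∀ x, f (t x) = g (f' x))
    (hs : ∀ x b, f x = g b → ∃ w, t w = x ∧ f' w = b) : IsProperSubmetry f' := by
  refine isProperSubmetry_of (fun b => ?_) (fun b => ?_) fun x b ε hε => ?_
  · obtain ⟨y, hy⟩ := h.1.1 (g b)
    obtain ⟨w, -, hw⟩ := hs y b hy
    exact ⟨w, hw⟩
  · have : CompactSpace (f ⁻¹' {g b}) := isCompact_iff_compactSpace.1 (h.isCompact_fiber _)
    -- The fibre of `f'` over `b` is the range of `σ`, which is 1-Lipschitz because its base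
    -- coordinate is constant.
    choose σ h₁ h₂ using fun x : f ⁻¹' {g b} => hs x.1 b x.2
    have hσ : Continuous σ := by
      refine (LipschitzWith.of_dist_le_mul (K := 1) fun x y => ?_).continuous
      refine (hd _ _).trans ?_
      rw [h₁, h₁, h₂, h₂, dist_self, NNReal.coe_one, one_mul]
      exact max_le le_rfl dist_nonneg
    convert isCompact_range hσ
    ext x
    constructor
    · rintro hx
      have hx : f' x = b := hx
      refine ⟨⟨t x, (comm x).trans (by rw [hx])⟩, dist_le_zero.1 ((hd _ _).trans ?_)⟩
      simp [h₁, h₂, hx]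
    · rintro ⟨y, rfl⟩
      exact h₂ y
  · obtain ⟨y, hy, hy'⟩ := h.exists_lift (t x) (g b)
    obtain ⟨w, hw, hw'⟩ := hs y b hy
    refine ⟨w, hw', ((hd _ _).trans (max_le ?_ ?_)).trans (le_add_of_nonneg_right hε.le)⟩
    · rw [hw]
      refine hy'.trans ?_
      rw [comm]
      exact Met.dist_map_le _ _ _
    · rw [hw']

end Proper


/-! ## Families of compact metric spaces with sections -/

/-- A proper submetry onto the metric space `B`, with `n` sections. -/
structure Fam (n : ℕ) (B : Met.{u}) : Type (u + 1) where
  P : Met.{u}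
  p : P ⟶ B
  proper : IsProperSubmetry p
  s : Fin n → (B ⟶ P)
  p_s : ∀ i b, p (s i b) = b

namespace Fam

variable {n : ℕ} {B B' B'' : Met.{u}}

/-- `t` is the top of a Cartesian square over `g`, compatible with the sections. -/
structure IsCart (A : Fam n B) (A' : Fam n B') (t : A.P ⟶ A'.P) (g : B ⟶ B') : Prop where
  comm : ∀ x, A'.p (t x) = g (A.p x)
  dist_le : ∀ x y, dist x y ≤ max (dist (t x) (t y)) (dist (A.p x) (A.p y))
  exists_lift : ∀ y b, A'.p y = g b → ∃ x, t x = y ∧ A.p x = b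
  sec : ∀ i b, t (A.s i b) = A'.s i (g b)

namespace IsCart

variable {A : Fam n B} {A' : Fam n B'} {A'' : Fam n B''} {t : A.P ⟶ A'.P} {g : B ⟶ B'}
  {t' : A'.P ⟶ A''.P} {g' : B' ⟶ B''}

lemma isPullback (h : A.IsCart A' t g) : IsPullback t A.p A'.p g :=
  Met.isPullback_of h.comm h.dist_le h.exists_lift

lemma of_isPullback (h : IsPullback t A.p A'.p g) (hs : ∀ i b, t (A.s i b) = A'.s i (g b)) :
    A.IsCart A' t g :=
  ⟨fun x => Met.congr h.w x, (Met.exists_of_isPullback h).1, (Met.exists_of_isPullback h).2, hs⟩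

lemma eq_of (h : A.IsCart A' t g) {x y : A.P} (h₁ : t x = t y) (h₂ : A.p x = A.p y) : x = y :=
  dist_le_zero.1 ((h.dist_le x y).trans (by simp [h₁, h₂]))

lemma id (A : Fam n B) : A.IsCart A (𝟙 _) (𝟙 _) :=
  ⟨fun _ => rfl, fun _ _ => le_max_left _ _, fun y _ h => ⟨y, rfl, h⟩, fun _ _ => rfl⟩

lemma comp (h : A.IsCart A' t g) (h' : A'.IsCart A'' t' g') : A.IsCart A'' (t ≫ t') (g ≫ g') where
  comm x := (h'.comm _).trans (congrArg g' (h.comm x))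
  dist_le x y := by
    refine (h.dist_le x y).trans (max_le ((h'.dist_le _ _).trans (max_le_max le_rfl ?_))
      (le_max_right _ _))
    rw [h.comm, h.comm]
    exact Met.dist_map_le _ _ _
  exists_lift y b e := by
    obtain ⟨x, hx, hx'⟩ := h'.exists_lift y (g b) e
    obtain ⟨z, hz, hz'⟩ := h.exists_lift x b hx'
    exact ⟨z, by rw [Met.comp_apply, hz, hx], hz'⟩
  sec i b := by rw [Met.comp_apply, h.sec, h'.sec]; rfl

/-- A square over `g` factors through a Cartesian square over `g'` if `g = k ≫ g'`. -/
lemma exists_factor {C : Met.{u}} {D : Fam n C} {r : D.P ⟶ A''.P} {k : C ⟶ B'} {l : C ⟶ B''}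
    (h' : A'.IsCart A'' t' g') (h : D.IsCart A'' r l) (e : ∀ c, l c = g' (k c)) :
    ∃ q : D.P ⟶ A'.P, D.IsCart A' q k ∧ ∀ x, t' (q x) = r x := by
  choose q hq hq' using fun x : D.P => h'.exists_lift (r x) (k (D.p x)) (by rw [h.comm, e])
  refine ⟨Met.mkHom q fun x y => (h'.dist_le _ _).trans ?_, ⟨hq', fun x y => ?_, fun y b hy => ?_,
    fun i b => ?_⟩, hq⟩
  · rw [hq, hq, hq', hq']
    exact max_le (Met.dist_map_le _ _ _)
      ((Met.dist_map_le _ _ _).trans (Met.dist_map_le _ _ _))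
  · refine (h.dist_le x y).trans (max_le_max ?_ le_rfl)
    rw [← hq, ← hq]
    exact Met.dist_map_le _ _ _
  · obtain ⟨x, hx, hx'⟩ := h.exists_lift (t' y) b (by rw [h'.comm, hy, e])
    refine ⟨x, h'.eq_of ((hq x).trans hx) ?_, hx'⟩
    rw [hy, ← hx']
    exact hq' x
  · refine h'.eq_of ((hq _).trans ?_) ((hq' _).trans ?_)
    · rw [h.sec, h'.sec, e]
    · rw [D.p_s, A'.p_s]

end IsCart

/-- The pullback of a family. -/
def pullback (A : Fam n B) (g : B' ⟶ B) : Fam n B' where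
  P := Met.pb A.p g
  p := Met.pbSnd A.p g
  proper := A.proper.of_cartesian (t := Met.pbFst A.p g) (g := g) (fun x y => (Met.pb_dist x y).le)
    (fun x => x.2) (fun x b e => ⟨⟨(x, b), e⟩, rfl, rfl⟩)
  s i := Met.mkHom (fun b => ⟨(A.s i (g b), b), A.p_s i _⟩) fun _ _ =>
    max_le ((Met.dist_map_le (A.s i) _ _).trans (Met.dist_map_le g _ _)) le_rfl
  p_s _ _ := rfl

/-- The projection from the pullback of a family. -/
def pullbackFst (A : Fam n B) (g : B' ⟶ B) : (A.pullback g).P ⟶ A.P := Met.pbFst A.p g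

lemma isCart_pullbackFst (A : Fam n B) (g : B' ⟶ B) :
    (A.pullback g).IsCart A (A.pullbackFst g) g where
  comm x := x.2
  dist_le x y := (Met.pb_dist x y).le
  exists_lift x b e := ⟨⟨(x, b), e⟩, rfl, rfl⟩
  sec _ _ := rfl

end Fam

/-! ## The fibred category `GH_n` -/

namespace GH

variable {n : ℕ}

/-- The object of `GH_n` given by a family. -/
def ofFam {S : TBMet.{u}} (A : Fam n S.obj) : (GH.{u} n).obj :=
  GHObj.mk S A.P A.p A.proper A.s fun i => Met.hom_ext (A.p_s i)

/-- The total space of an object of `GH_n`. -/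
def total (x : (GH.{u} n).obj) : Met.{u} := GHObj.P x

/-- The map of total spaces given by a morphism of `GH_n`. -/
def tot {x y : (GH.{u} n).obj} (φ : x ⟶ y) : total x ⟶ total y := GHObj.Hom.tot φ

@[simp]
lemma tot_comp_apply {x y z : (GH.{u} n).obj} (φ : x ⟶ y) (ψ : y ⟶ z) (q : total x) :
    tot (φ ≫ ψ) q = tot ψ (tot φ q) := rfl

/-- The family over `S` underlying an object of `GH_n` over `S`. -/
abbrev fam (x : (GH.{u} n).obj) {S : TBMet.{u}} (h : (GH n).p.obj x = S) : Fam n S.obj where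
  P := total x
  p := GHObj.p x ≫ (eqToHom h).hom
  proper := by
    subst h
    exact GHObj.proper x
  s i := (eqToHom h.symm).hom ≫ GHObj.s x i
  p_s i := by
    subst h
    exact Met.congr (GHObj.s_p x i)

variable {x y : (GH.{u} n).obj} {S S' : TBMet.{u}} {b : S ⟶ S'}

/-- With the two lemmas that follow, a dictionary between morphisms over `b` and Cartesian squares
of families. -/
lemma isCart_of_isHomLift (hx : (GH n).p.obj x = S) (hy : (GH n).p.obj y = S') (φ : x ⟶ y)
    (h : (GH n).p.IsHomLift b φ) : (fam x hx).IsCart (fam y hy) (tot φ) b.hom := by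
  subst hx hy
  obtain rfl := IsHomLift.eq_of_isHomLift (GH n).p b φ
  exact Fam.IsCart.of_isPullback (GHObj.Hom.isPullback φ) fun i =>
    Met.congr (GHObj.Hom.s_tot φ i)

lemma exists_hom_of_isCart (hx : (GH n).p.obj x = S) (hy : (GH n).p.obj y = S')
    {t : total x ⟶ total y} (h : (fam x hx).IsCart (fam y hy) t b.hom) :
    ∃ φ : x ⟶ y, (GH n).p.IsHomLift b φ ∧ tot φ = t := by
  subst hx hy
  let φ : x ⟶ y := GHObj.Hom.mk t b h.isPullback fun i => Met.hom_ext (h.sec i)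
  exact ⟨φ, IsHomLift.map (GH n).p φ, rfl⟩

lemma hom_ext_of_isHomLift {φ ψ : x ⟶ y} (h : (GH n).p.IsHomLift b φ) (h' : (GH n).p.IsHomLift b ψ)
    (e : ∀ q, tot φ q = tot ψ q) : φ = ψ := by
  obtain rfl := IsHomLift.domain_eq (GH n).p b φ
  obtain rfl := IsHomLift.codomain_eq (GH n).p b φ
  refine GHObj.Hom.ext (Met.hom_ext e) ?_
  exact (IsHomLift.eq_of_isHomLift (GH n).p b φ).symm.trans (IsHomLift.eq_of_isHomLift (GH n).p b ψ)

end GH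

/-- All morphisms of `𝒳` are strongly Cartesian. -/
def AllCartesian {C : Type w} [Category.{v} C] (𝒳 : BasedCategory.{u, u + 1} C) : Prop :=
  ∀ (x y : 𝒳.obj) (φ : x ⟶ y), 𝒳.p.IsStronglyCartesian (𝒳.p.map φ) φ

namespace AllCartesian

variable {C : Type w} [Category.{v} C] {𝒳 : BasedCategory.{u, u + 1} C} (h𝒳 : AllCartesian 𝒳)
include h𝒳

lemma isStronglyCartesian {x y : 𝒳.obj} {R S : C} (f : R ⟶ S)
    (φ : x ⟶ y) (h : 𝒳.p.IsHomLift f φ) : 𝒳.p.IsStronglyCartesian f φ := by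
  obtain ⟨⟩ := h
  exact h𝒳 _ _ φ

lemma isIso {x y : 𝒳.obj} {S : C} (φ : x ⟶ y) (h : 𝒳.p.IsHomLift (𝟙 S) φ) : IsIso φ := by
  have := h𝒳.isStronglyCartesian _ _ h
  exact IsStronglyCartesian.isIso_of_base_isIso 𝒳.p (𝟙 S) φ

lemma isFiberedInGroupoids (h : ∀ (a : 𝒳.obj) (R : C) (f : R ⟶ 𝒳.p.obj a),
    ∃ (b : 𝒳.obj) (φ : b ⟶ a), 𝒳.p.IsHomLift f φ) : IsFiberedInGroupoids 𝒳 := by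
  refine ⟨IsFibered.of_exists_isStronglyCartesian fun a R f => ?_, fun S => ⟨fun {x y} φ => ?_⟩⟩
  · obtain ⟨b, φ, hφ⟩ := h a R f
    exact ⟨b, φ, h𝒳.isStronglyCartesian f φ hφ⟩
  · have := φ.2
    have := h𝒳.isIso φ.1 φ.2
    exact ⟨⟨inv φ.1, IsHomLift.lift_id_inv_isIso 𝒳.p S φ.1⟩, Subtype.ext (IsIso.hom_inv_id φ.1),
      Subtype.ext (IsIso.inv_hom_id φ.1)⟩

end AllCartesian

/-- Cartesian squares factor through one another, and a point of the middle total space is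
determined by its image and its base point, which gives uniqueness. -/
lemma allCartesian_GH (n : ℕ) : AllCartesian (GH.{u} n) := by
  intro x y φ
  refine ⟨fun {z} g χ hχ => ?_⟩
  have h := GH.isCart_of_isHomLift rfl rfl φ (IsHomLift.map (GH n).p φ)
  have h' := GH.isCart_of_isHomLift rfl rfl χ hχ
  obtain ⟨q, hq, hq'⟩ := h.exists_factor h' (k := g.hom) fun _ => rfl
  obtain ⟨ψ, hψ, hψ'⟩ := GH.exists_hom_of_isCart rfl rfl hq
  refine ⟨ψ, ⟨hψ, ?_⟩, fun ψ' ⟨h₁, h₂⟩ => ?_⟩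
  · refine GH.hom_ext_of_isHomLift (IsHomLift.comp (GH n).p g ((GH n).p.map φ) ψ φ) hχ fun x => ?_
    rw [← hq', GH.tot_comp_apply, hψ']
  · refine GH.hom_ext_of_isHomLift h₁ hψ fun x => ?_
    have k := GH.isCart_of_isHomLift rfl rfl ψ' h₁
    refine h.eq_of ?_ ((k.comm _).trans ?_)
    · rw [hψ', hq', ← h₂]
      rfl
    · rw [hψ']
      exact (hq.comm x).symm

theorem isFiberedInGroupoids_GH (n : ℕ) : IsFiberedInGroupoids (GH.{u} n) := by
  refine (allCartesian_GH n).isFiberedInGroupoids fun a R f => ?_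
  obtain ⟨φ, hφ, -⟩ := GH.exists_hom_of_isCart (x := GH.ofFam ((GH.fam a rfl).pullback f.hom))
    rfl rfl ((GH.fam a rfl).isCart_pullbackFst f.hom)
  exact ⟨_, φ, hφ⟩


/-! ## Gluing families -/

namespace Fam

variable {n : ℕ} {X : Met.{u}} {I : Type u} {U : I → Met.{u}}

/-- A gluing datum for families `A i` over the `U i`, with respect to maps `f i : U i ⟶ X`: it
identifies the fibres over points with the same image in `X`. -/
structure Gluing (f : ∀ i, U i ⟶ X) (A : ∀ i, Fam n (U i)) where
  τ : ∀ (i j : I) (p : (A i).P) (v : U j), f i ((A i).p p) = f j v → (A j).P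
  p_τ : ∀ i j p v h, (A j).p (τ i j p v h) = v
  dist_τ_le : ∀ i j p p' v v' h h',
    dist (τ i j p v h) (τ i j p' v' h') ≤ max (dist p p') (dist v v')
  cocycle : ∀ i j k p v w h h' h'', τ j k (τ i j p v h) w h' = τ i k p w h''
  τ_self : ∀ i p h, τ i i p ((A i).p p) h = p
  τ_s : ∀ i j l u v h, τ i j ((A i).s l u) v h = (A j).s l v

namespace Gluing

variable {f : ∀ i, U i ⟶ X} {A : ∀ i, Fam n (U i)} (G : Gluing f A)

/-- The points of the glued family, before identifications. -/
structure Pts (_ : Gluing f A) : Type u where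
  i : I
  p : (A i).P

variable {G}

/-- The point of `X` below a point of the glued family. -/
abbrev base (a : G.Pts) : X := f a.1 ((A a.1).p a.2)

/-- Pairs of points over the images of `a` and `b` in a member of the covering. -/
structure Idx (a b : G.Pts) : Type u where
  k : I
  fst : U k
  snd : U k
  fst_eq : base a = f k fst
  snd_eq : base b = f k snd

/-- The distance of the representatives of `a` and `b` in a member of the covering. -/
def val {a b : G.Pts} (c : Idx a b) : ℝ :=
  dist (G.τ a.1 c.k a.2 c.fst c.fst_eq) (G.τ b.1 c.k b.2 c.snd c.snd_eq)

/-- The distance in the glued family. -/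
noncomputable def gdist (a b : G.Pts) : ℝ := ⨅ c : Idx a b, val c

lemma val_nonneg {a b : G.Pts} (c : Idx a b) : 0 ≤ val c := dist_nonneg

lemma gdist_le {a b : G.Pts} (c : Idx a b) : gdist a b ≤ val c :=
  ciInf_le ⟨0, by rintro _ ⟨c, rfl⟩; exact val_nonneg c⟩ c

lemma gdist_nonneg (a b : G.Pts) : 0 ≤ gdist a b := Real.iInf_nonneg val_nonneg

/-- Transport from the chart of `c` to that of `c'` carries one pair of representatives to the other
by the cocycle condition, and `dist_τ_le` controls distances. Thus the choice of chart matters only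
up to the distance in the base. -/
lemma val_le_max {a b : G.Pts} (c c' : Idx a b) :
    val c' ≤ max (val c) (dist c'.fst c'.snd) := by
  obtain ⟨i, u₁, u₂, h₁, h₂⟩ := c
  obtain ⟨j, v₁, v₂, k₁, k₂⟩ := c'
  have e₁ : f i ((A i).p (G.τ a.1 i a.2 u₁ h₁)) = f j v₁ := by rw [G.p_τ, ← h₁, ← k₁]
  have e₂ : f i ((A i).p (G.τ b.1 i b.2 u₂ h₂)) = f j v₂ := by rw [G.p_τ, ← h₂, ← k₂]
  have := G.dist_τ_le i j _ _ v₁ v₂ e₁ e₂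
  rwa [G.cocycle, G.cocycle] at this

/-- The family of maps is a covering, in the sense of lifting triples of points. -/
def Covers (f : ∀ i, U i ⟶ X) : Prop :=
  ∀ (x₁ x₂ x₃ : X) (ε : ℝ), 0 < ε → ∃ (i : I) (u₁ u₂ u₃ : U i),
    f i u₁ = x₁ ∧ f i u₂ = x₂ ∧ f i u₃ = x₃ ∧
    dist u₁ u₂ < dist x₁ x₂ + ε ∧ dist u₂ u₃ < dist x₂ x₃ + ε

lemma Covers.exists_pair (hf : Covers f) (x₁ x₂ : X) {ε : ℝ} (hε : 0 < ε) :
    ∃ (i : I) (u₁ u₂ : U i), f i u₁ = x₁ ∧ f i u₂ = x₂ ∧ dist u₁ u₂ < dist x₁ x₂ + ε := by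
  obtain ⟨i, u₁, u₂, _, h₁, h₂, -, h, -⟩ := hf x₁ x₂ x₂ ε hε
  exact ⟨i, u₁, u₂, h₁, h₂, h⟩

lemma Covers.exists_point (hf : Covers f) (x : X) : ∃ (i : I) (u : U i), f i u = x := by
  obtain ⟨i, u, _, _, h, -⟩ := hf x x x 1 one_pos
  exact ⟨i, u, h⟩

section

variable (hf : Covers f)
include hf

lemma nonempty_idx (a b : G.Pts) : Nonempty (Idx a b) := by
  obtain ⟨i, u₁, u₂, h₁, h₂, -⟩ := hf.exists_pair (base a) (base b) one_pos
  exact ⟨i, u₁, u₂, h₁.symm, h₂.symm⟩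

/-- Consequently a pair of base points no further apart than `gdist a b` realises the infimum; the
covering condition supplies such pairs up to any ε. -/
lemma val_le_max_gdist {a b : G.Pts} (c : Idx a b) :
    val c ≤ max (gdist a b) (dist c.fst c.snd) := by
  by_contra! h
  obtain ⟨h₁, h₂⟩ := max_lt_iff.1 h
  have := nonempty_idx hf a b
  obtain ⟨c', hc'⟩ := exists_lt_of_ciInf_lt h₁
  exact absurd (val_le_max c' c) (not_le.2 (max_lt hc' h₂))

lemma dist_base_le (a b : G.Pts) : dist (base a) (base b) ≤ gdist a b := by
  have := nonempty_idx hf a b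
  refine le_ciInf fun c => ?_
  obtain ⟨k, u, v, h, h'⟩ := c
  rw [h, h']
  refine (Met.dist_map_le _ _ _).trans ?_
  have := Met.dist_map_le (A k).p (G.τ a.1 k a.2 u h) (G.τ b.1 k b.2 v h')
  rwa [G.p_τ, G.p_τ] at this

/-- Here triples must be lifted: one chart contains representatives of all three points with both
consecutive base distances almost minimal, and the triangle inequality of a single family applies
there. -/
lemma gdist_triangle (a b c : G.Pts) : gdist a c ≤ gdist a b + gdist b c := by
  refine le_of_forall_pos_le_add fun ε hε => ?_
  obtain ⟨i, u₁, u₂, u₃, h₁, h₂, h₃, h, h'⟩ := hf (base a) (base b) (base c) (ε / 2) (half_pos hε)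
  have k₁ := val_le_max_gdist hf (⟨i, u₁, u₂, h₁.symm, h₂.symm⟩ : Idx a b)
  have k₂ := val_le_max_gdist hf (⟨i, u₂, u₃, h₂.symm, h₃.symm⟩ : Idx b c)
  have k₃ := gdist_le (⟨i, u₁, u₃, h₁.symm, h₃.symm⟩ : Idx a c)
  have t := dist_triangle (G.τ a.1 i a.2 u₁ h₁.symm) (G.τ b.1 i b.2 u₂ h₂.symm)
    (G.τ c.1 i c.2 u₃ h₃.symm)
  have d₁ : max (gdist a b) (dist u₁ u₂) ≤ gdist a b + ε / 2 :=
    max_le (by linarith) (by linarith [dist_base_le hf a b])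
  have d₂ : max (gdist b c) (dist u₂ u₃) ≤ gdist b c + ε / 2 :=
    max_le (by linarith) (by linarith [dist_base_le hf b c])
  have k₁ := k₁.trans d₁
  have k₂ := k₂.trans d₂
  have k₃ := k₃.trans t
  change dist _ _ ≤ _ at k₁ k₂
  linarith

/-- The pseudometric on the points of the glued family. -/
noncomputable abbrev pseudoMetric : PseudoMetricSpace G.Pts where
  dist := gdist
  dist_self a := by
    obtain ⟨i, u, h⟩ := hf.exists_point (base a)
    refine le_antisymm ((gdist_le ⟨i, u, u, h.symm, h.symm⟩).trans ?_) (gdist_nonneg a a)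
    exact (dist_self _).le
  dist_comm := by
    have key : ∀ a b : G.Pts, gdist a b ≤ gdist b a := fun a b => by
      have := nonempty_idx hf b a
      refine le_ciInf fun c => (gdist_le ⟨c.k, c.snd, c.fst, c.snd_eq, c.fst_eq⟩).trans ?_
      exact (dist_comm _ _).le
    exact fun a b => le_antisymm (key a b) (key b a)
  dist_triangle := gdist_triangle hf

variable (G) in
/-- The total space of the glued family. -/
noncomputable def glued : Met.{u} :=
  letI := pseudoMetric (G := G) hf
  ⟨SeparationQuotient G.Pts⟩

/-- The class of a point in the glued family. -/
noncomputable def cls (a : G.Pts) : G.glued hf :=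
  letI := pseudoMetric (G := G) hf
  SeparationQuotient.mk a

lemma cls_surjective : Function.Surjective (cls (G := G) hf) :=
  letI := pseudoMetric (G := G) hf
  SeparationQuotient.surjective_mk

lemma dist_cls (a b : G.Pts) : dist (cls hf a) (cls hf b) = gdist a b := rfl

/-- In the chart `j`, with `v` taken twice, both points have the same representative by the cocycle
condition. -/
lemma cls_τ (a : G.Pts) (j : I) (v : U j) (h : base a = f j v) :
    cls hf ⟨j, G.τ a.1 j a.2 v h⟩ = cls hf a := by
  refine dist_le_zero.1 ?_
  rw [dist_cls]
  refine (gdist_le ⟨j, v, v, ?_, h⟩).trans ?_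
  · exact congrArg (f j) (G.p_τ _ _ _ _ h)
  · change dist _ _ ≤ 0
    rw [G.cocycle _ _ _ _ _ _ h _ h, dist_self]

lemma dist_cls_le (i : I) (p q : (A i).P) :
    dist (cls (G := G) hf ⟨i, p⟩) (cls hf ⟨i, q⟩) ≤ dist p q := by
  refine (gdist_le (G := G) (a := ⟨i, p⟩) (b := ⟨i, q⟩)
    ⟨i, (A i).p p, (A i).p q, rfl, rfl⟩).trans ?_
  change dist _ _ ≤ _
  rw [G.τ_self, G.τ_self]

lemma dist_le_max_cls (i : I) (p q : (A i).P) :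
    dist p q ≤ max (dist (cls (G := G) hf ⟨i, p⟩) (cls hf ⟨i, q⟩))
      (dist ((A i).p p) ((A i).p q)) := by
  have := val_le_max_gdist (G := G) (a := ⟨i, p⟩) (b := ⟨i, q⟩) hf
    ⟨i, (A i).p p, (A i).p q, rfl, rfl⟩
  change dist _ _ ≤ _ at this
  rwa [G.τ_self, G.τ_self] at this

variable (G) in
/-- The projection of the glued family. -/
noncomputable def proj : G.glued hf ⟶ X :=
  letI := pseudoMetric (G := G) hf
  Met.mkHom (SeparationQuotient.lift base fun a b h => dist_le_zero.1
    ((dist_base_le hf a b).trans (Metric.inseparable_iff.1 h).le)) fun a b => by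
      obtain ⟨a, rfl⟩ := SeparationQuotient.surjective_mk a
      obtain ⟨b, rfl⟩ := SeparationQuotient.surjective_mk b
      exact dist_base_le hf a b

lemma proj_cls (a : G.Pts) : G.proj hf (cls hf a) = base a := rfl

/-- Everything is inherited from one chart: the fibre over `f i u` is a 1-Lipschitz image of the
fibre over `u`, and lifting a pair of base points costs only ε. -/
lemma isProperSubmetry_proj : IsProperSubmetry (G.proj hf) := by
  refine isProperSubmetry_of (fun x => ?_) (fun x => ?_) fun a x' ε hε => ?_
  · obtain ⟨i, u, rfl⟩ := hf.exists_point x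
    obtain ⟨p, rfl⟩ := (A i).proper.1.1 u
    exact ⟨cls hf ⟨i, p⟩, rfl⟩
  · obtain ⟨i, u, rfl⟩ := hf.exists_point x
    have hc : Continuous fun p : (A i).P => cls (G := G) hf ⟨i, p⟩ :=
      (LipschitzWith.of_dist_le_mul (K := 1) (by simpa using dist_cls_le (G := G) hf i)).continuous
    convert ((A i).proper.isCompact_fiber u).image hc
    ext a
    obtain ⟨a, rfl⟩ := cls_surjective hf a
    constructor
    · intro h
      exact ⟨_, G.p_τ _ _ _ u h, cls_τ hf a i u h⟩
    · rintro ⟨p, rfl, h⟩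
      rw [← h]
      rfl
  · obtain ⟨a, rfl⟩ := cls_surjective hf a
    obtain ⟨i, u, u', h, rfl, hu⟩ := hf.exists_pair (base a) x' hε
    obtain ⟨q, rfl, hq⟩ := (A i).proper.exists_lift (G.τ a.1 i a.2 u h.symm) u'
    refine ⟨cls hf ⟨i, q⟩, rfl, ?_⟩
    rw [← cls_τ hf a i u h.symm]
    refine (dist_cls_le hf _ _ _).trans (hq.trans ?_)
    rw [G.p_τ, proj_cls]
    refine hu.le.trans (le_of_eq ?_)
    congr 2
    exact h.symm.trans (congrArg (f i) (G.p_τ _ _ _ _ _)).symm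

lemma gdist_s_le (l : Fin n) {i j : I} (u : U i) (v : U j) :
    gdist (G := G) ⟨i, (A i).s l u⟩ ⟨j, (A j).s l v⟩ ≤ dist (f i u) (f j v) := by
  refine le_of_forall_pos_le_add fun ε hε => ?_
  obtain ⟨k, w, w', h, h', hw⟩ := hf.exists_pair (f i u) (f j v) hε
  refine (gdist_le ⟨k, w, w', ?_, ?_⟩).trans ?_
  · rw [h]
    exact congrArg (f i) ((A i).p_s _ _)
  · rw [h']
    exact congrArg (f j) ((A j).p_s _ _)
  · change dist _ _ ≤ _
    rw [G.τ_s, G.τ_s]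
    exact (Met.dist_map_le _ _ _).trans hw.le

/-- Families descend along coverings. -/
theorem exists_glued (G : Gluing f A) : ∃ (B : Fam n X) (t : ∀ i, (A i).P ⟶ B.P),
    (∀ i, (A i).IsCart B (t i) (f i)) ∧ ∀ i j p v h, t j (G.τ i j p v h) = t i p := by
  -- Sections are computed in an arbitrary chart over each point; by `gdist_s_le` the choice does
  -- not affect the class.
  choose i u hu using hf.exists_point
  let B : Fam n X :=
    { P := G.glued hf
      p := G.proj hf
      proper := isProperSubmetry_proj hf
      s := fun l => Met.mkHom (fun x => cls hf ⟨i x, (A (i x)).s l (u x)⟩) fun x y => by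
        have := gdist_s_le (G := G) hf l (u x) (u y)
        rwa [hu, hu] at this
      p_s := fun l x => (congrArg (f (i x)) ((A (i x)).p_s l (u x))).trans (hu x) }
  refine ⟨B, fun j => Met.mkHom (fun p => cls hf ⟨j, p⟩) (dist_cls_le hf j), fun j =>
    ⟨fun p => rfl, dist_le_max_cls hf j, fun y b h => ?_, fun l b => ?_⟩,
    fun j k p v h => cls_τ hf ⟨j, p⟩ k v h⟩
  · obtain ⟨a, rfl⟩ := cls_surjective hf y
    exact ⟨G.τ a.1 j a.2 b h, cls_τ hf a j b h, G.p_τ _ _ _ _ _⟩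
  · refine dist_le_zero.1 ((gdist_s_le (G := G) hf l _ _).trans ?_)
    rw [hu, dist_self]

end

end Gluing

end Fam


/-! ### Pullbacks in `GH n` and coverings -/

lemma IsLsmCovering.covers {X : TBMet.{u}} {I : Type u} {U : I → TBMet.{u}} {f : ∀ i, U i ⟶ X}
    (hf : IsLsmCovering U f) : Fam.Gluing.Covers fun i => (f i).hom := hf.2

/-- The inclusion of a point in a totally bounded space. -/
def ptMap {X : TBMet.{u}} (x : X.obj) : pt.{u} ⟶ X where
  hom := ⟨fun _ => x, LipschitzWith.const' x⟩

namespace GH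

variable {n : ℕ}

/-- The pullback of an object of `GH_n`. -/
def pull {S S' : TBMet.{u}} (x : Fiber (GH.{u} n).p S) (g : S' ⟶ S) : (GH.{u} n).obj :=
  ofFam ((fam x.1 x.2).pullback g.hom)

variable {S S' S'' : TBMet.{u}}

lemma exists_pull_hom (x : Fiber (GH.{u} n).p S) (g : S' ⟶ S) :
    ∃ a : pull x g ⟶ x.1, (GH n).p.IsHomLift g a ∧
      tot a = (fam x.1 x.2).pullbackFst g.hom :=
  exists_hom_of_isCart (x := pull x g) rfl x.2 ((fam x.1 x.2).isCart_pullbackFst g.hom)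

/-- The projection from the pullback of an object of `GH_n`. -/
noncomputable def pullHom (x : Fiber (GH.{u} n).p S) (g : S' ⟶ S) : pull x g ⟶ x.1 :=
  (exists_pull_hom x g).choose

instance isHomLift_pullHom (x : Fiber (GH.{u} n).p S) (g : S' ⟶ S) :
    (GH n).p.IsHomLift g (pullHom x g) := (exists_pull_hom x g).choose_spec.1

lemma tot_pullHom (x : Fiber (GH.{u} n).p S) (g : S' ⟶ S) :
    tot (pullHom x g) = (fam x.1 x.2).pullbackFst g.hom := (exists_pull_hom x g).choose_spec.2

/-- The point of the pullback given by a point of the total space and a point of the base. -/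
def pullPt (x : Fiber (GH.{u} n).p S) (g : S' ⟶ S) (p : total x.1) (b : S'.obj)
    (h : (fam x.1 x.2).p p = g.hom b) : total (pull x g) := ⟨(p, b), h⟩

lemma tot_pullHom_pullPt (x : Fiber (GH.{u} n).p S) (g : S' ⟶ S) (p : total x.1) (b : S'.obj)
    (h : (fam x.1 x.2).p p = g.hom b) : tot (pullHom x g) (pullPt x g p b h) = p := by
  rw [tot_pullHom]
  rfl

lemma eq_pullPt (x : Fiber (GH.{u} n).p S) (g : S' ⟶ S) (q : total (pull x g)) :
    ∃ p b h, q = pullPt x g p b h := ⟨q.1.1, q.1.2, q.2, rfl⟩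

/-- A morphism to an object of `GH_n` factors through a pullback. -/
lemma exists_factor_pull (x : Fiber (GH.{u} n).p S) (g : S' ⟶ S) {z : (GH n).obj}
    (hz : (GH n).p.obj z = S'') (b : S'' ⟶ S) (a : z ⟶ x.1) (ha : (GH n).p.IsHomLift b a)
    (k : S'' ⟶ S') (hk : b = k ≫ g) :
    ∃ c : z ⟶ pull x g, (GH n).p.IsHomLift k c ∧ c ≫ pullHom x g = a ∧
      ∀ q, ∃ h, tot c q = pullPt x g (tot a q) (k.hom ((fam z hz).p q)) h := by
  have := (allCartesian_GH n).isStronglyCartesian g (pullHom x g) (isHomLift_pullHom x g)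
  let c := IsStronglyCartesian.map (GH n).p g (pullHom x g) hk a
  have hc : (GH n).p.IsHomLift k c := IsStronglyCartesian.map_isHomLift _ _ _ _ _
  have hca : c ≫ pullHom x g = a := IsStronglyCartesian.fac _ _ _ _ _
  have H := isCart_of_isHomLift hz rfl c hc
  refine ⟨c, hc, hca, fun q => ?_⟩
  obtain ⟨p, b', h, e⟩ := eq_pullPt x g (tot c q)
  have e₁ : p = tot a q := by
    rw [← hca, tot_comp_apply, e, tot_pullHom_pullPt]
  have e₂ : b' = k.hom ((fam z hz).p q) := by
    rw [← H.comm q]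
    exact congrArg (fun r => (fam (pull x g) rfl).p r) e.symm
  subst e₁ e₂
  exact ⟨h, e⟩

end GH

/-! ### Morphisms between families glue -/

section Sheaf

variable {n : ℕ} {X : TBMet.{u}} {I : Type u} {U : I → TBMet.{u}} {f : ∀ i, U i ⟶ X}

open GH

/-- A point of `x` is lifted to the pullback to some `U i` and sent to `y` by the morphism given
there. Restriction to single fibres shows independence of the chart; pairs lifted with almost no
loss in base distance show that the resulting map is 1-Lipschitz and Cartesian. -/
theorem isomIsSheafFor_GH (hf : IsLsmCovering U f) : IsomIsSheafFor (GH.{u} n) U f := by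
  intro x y φ hφ hnat
  have hcov := hf.covers
  have hsieve : ∀ i {V : TBMet.{u}} (k : V ⟶ U i), Sieve.ofArrows U f (k ≫ f i) := fun i V k =>
    (Sieve.ofArrows U f).downward_closed (Sieve.ofArrows_mk U f i) k
  have hsieve' : ∀ i, Sieve.ofArrows U f (f i) := fun i => Sieve.ofArrows_mk U f i
  let A := fam x.1 x.2
  let B := fam y.1 y.2
  let F : ∀ i, pull x (f i) ⟶ y.1 := fun i =>
    φ (pull x (f i)) (f i) (pullHom x (f i)) (isHomLift_pullHom x (f i)) (hsieve' i)
  have hF : ∀ i, (fam (pull x (f i)) rfl).IsCart B (tot (F i)) (f i).hom := fun i =>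
    isCart_of_isHomLift (x := pull x (f i)) rfl y.2 (F i) (hφ _ _ _ _ _)
  have hcongr : ∀ z g a a' (ha : (GH n).p.IsHomLift g a) (ha' : (GH n).p.IsHomLift g a') hg,
      a = a' → φ z g a ha hg = φ z g a' ha' hg := by
    rintro z g a _ ha ha' hg rfl
    rfl
  have indep : ∀ i j p u v h h',
      tot (F i) (pullPt x (f i) p u h) = tot (F j) (pullPt x (f j) p v h') := by
    intro i j p u v h h'
    -- Charts are compared on a single fibre of `x`: it maps to both pullbacks over the same map to
    -- `X`, so naturality of `φ` makes the two values agree.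
    let w := pull x (ptMap ((fam x.1 x.2).p p))
    have e₁ : ptMap ((fam x.1 x.2).p p) = ptMap u ≫ f i :=
      InducedCategory.hom_ext (Met.hom_ext fun _ => h)
    have e₂ : ptMap ((fam x.1 x.2).p p) = ptMap v ≫ f j :=
      InducedCategory.hom_ext (Met.hom_ext fun _ => h')
    obtain ⟨c, hc, hca, hcq⟩ := exists_factor_pull x (f i) (z := w) rfl _ (pullHom x _)
      (isHomLift_pullHom x _) (ptMap u) e₁
    obtain ⟨d, hd, hda, hdq⟩ := exists_factor_pull x (f j) (z := w) rfl _ (pullHom x _)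
      (isHomLift_pullHom x _) (ptMap v) e₂
    have hw : Sieve.ofArrows U f (ptMap ((fam x.1 x.2).p p)) := by
      rw [e₁]
      exact hsieve i _
    have k₁ := hnat _ w c (f i) (pullHom x (f i)) (isHomLift_pullHom x (f i)) (hsieve' i)
      (ptMap ((fam x.1 x.2).p p)) (by rw [hca]; exact isHomLift_pullHom x _) hw
    have k₂ := hnat _ w d (f j) (pullHom x (f j)) (isHomLift_pullHom x (f j)) (hsieve' j)
      (ptMap ((fam x.1 x.2).p p)) (by rw [hda]; exact isHomLift_pullHom x _) hw
    have k : c ≫ F i = d ≫ F j :=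
      k₁.symm.trans ((hcongr _ _ _ _ _ _ _ (hca.trans hda.symm)).trans k₂)
    let q : total w := pullPt x (ptMap ((fam x.1 x.2).p p)) p PUnit.unit rfl
    have hq : tot (pullHom x (ptMap ((fam x.1 x.2).p p))) q = p := tot_pullHom_pullPt _ _ _ _ _
    have k' : tot (F i) (tot c q) = tot (F j) (tot d q) := Met.congr (congrArg tot k) q
    obtain ⟨h₁, e₁⟩ := hcq q
    obtain ⟨h₂, e₂⟩ := hdq q
    have e₁' : tot c q = pullPt x (f i) p u h := by
      rw [e₁]
      exact Subtype.ext (Prod.ext hq rfl)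
    have e₂' : tot d q = pullPt x (f j) p v h' := by
      rw [e₂]
      exact Subtype.ext (Prod.ext hq rfl)
    rwa [e₁', e₂'] at k'
  choose i u hu using hcov.exists_point
  let t₀ : A.P → B.P := fun p => tot (F (i (A.p p))) (pullPt x _ p (u (A.p p)) (hu _).symm)
  have ht₀ : ∀ j p v h, t₀ p = tot (F j) (pullPt x (f j) p v h) := fun j p v h =>
    indep _ _ _ _ _ _ _
  have pair : ∀ (p p' : A.P) (ε : ℝ), 0 < ε → ∃ j v v' h h',
      t₀ p = tot (F j) (pullPt x (f j) p v h) ∧ t₀ p' = tot (F j) (pullPt x (f j) p' v' h') ∧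
      dist v v' < dist (A.p p) (A.p p') + ε := by
    intro p p' ε hε
    obtain ⟨j, v, v', h, h', hv⟩ := hcov.exists_pair (A.p p) (A.p p') hε
    exact ⟨j, v, v', h.symm, h'.symm, ht₀ _ _ _ _, ht₀ _ _ _ _, hv⟩
  let t : A.P ⟶ B.P := Met.mkHom t₀ fun p p' => by
    refine le_of_forall_pos_le_add fun ε hε => ?_
    obtain ⟨j, v, v', h, h', e, e', hv⟩ := pair p p' ε hε
    rw [e, e']
    refine (Met.dist_map_le _ _ _).trans (max_le ?_ ?_)
    · exact le_add_of_nonneg_right hε.le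
    · exact hv.le.trans (by gcongr; exact Met.dist_map_le _ _ _)
  have ht : A.IsCart B t (𝟙 X.obj) := by
    refine ⟨fun p => ?_, fun p p' => ?_, fun y' b hy => ?_, fun l b => ?_⟩
    · obtain ⟨j, v, h⟩ := hcov.exists_point (A.p p)
      refine (congrArg B.p (ht₀ j p v h.symm)).trans (((hF j).comm _).trans ?_)
      exact h
    · refine le_of_forall_pos_le_add fun ε hε => ?_
      obtain ⟨j, v, v', h, h', e, e', hv⟩ := pair p p' ε hε
      change _ ≤ max (dist (t₀ p) (t₀ p')) _ + ε
      rw [e, e']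
      have : dist p p' ≤ dist (pullPt x (f j) p v h) (pullPt x (f j) p' v' h') := le_max_left _ _
      refine this.trans (((hF j).dist_le _ _).trans ?_)
      rw [← max_add_add_right]
      exact max_le_max (le_add_of_nonneg_right hε.le) hv.le
    · obtain ⟨j, v, h⟩ := hcov.exists_point b
      obtain ⟨q, hq, hq'⟩ := (hF j).exists_lift y' v (hy.trans h.symm)
      obtain ⟨p, v', h', rfl⟩ := eq_pullPt x (f j) q
      refine ⟨p, (ht₀ j p v' h').trans hq, ?_⟩
      have : v' = v := hq'
      rw [← h, ← this]
      exact h'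
    · obtain ⟨j, v, rfl⟩ := hcov.exists_point b
      refine (ht₀ j _ v (A.p_s l _)).trans ?_
      exact (hF j).sec l v
  obtain ⟨ψ, hψ, hψt⟩ := exists_hom_of_isCart (b := 𝟙 X) x.2 y.2 ht
  refine ⟨⟨ψ, hψ⟩, fun z g a ha hg => ?_, fun ψ' hψ' => ?_⟩
  · obtain ⟨j, k, rfl⟩ : ∃ j k, g = k ≫ f j := by
      obtain ⟨Y, k, _, ⟨j⟩, rfl⟩ := hg
      exact ⟨j, k, rfl⟩
    refine hom_ext_of_isHomLift (hφ _ _ _ ha hg) (IsHomLift.comp_lift_id_right _ _ _ _)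
      fun q => ?_
    obtain ⟨c, hc, hca, hcq⟩ := exists_factor_pull x (f j) (z := z) rfl _ a ha k rfl
    have k₁ := hnat _ z c (f j) (pullHom x (f j)) (isHomLift_pullHom x (f j)) (hsieve' j)
      (k ≫ f j) (by rwa [hca]) hg
    have k₂ : φ z (k ≫ f j) a ha hg = c ≫ F j := by
      rw [← k₁]
      exact hcongr _ _ _ _ _ _ _ hca.symm
    obtain ⟨h, e⟩ := hcq q
    rw [k₂, tot_comp_apply, tot_comp_apply, e, hψt]
    exact (ht₀ j _ _ _).symm
  · refine Subtype.ext (hom_ext_of_isHomLift ψ'.2 hψ fun p => ?_)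
    obtain ⟨j, v, h⟩ := hcov.exists_point (A.p p)
    rw [hψt]
    refine Eq.trans ?_ (ht₀ j p v h.symm).symm
    have := Met.congr (congrArg tot (hψ' (pull x (f j)) (f j) (pullHom x (f j))
      (isHomLift_pullHom x (f j)) (hsieve' j))) (pullPt x (f j) p v h.symm)
    refine Eq.trans ?_ this.symm
    rw [tot_comp_apply, tot_pullHom_pullPt]

end Sheaf


/-- The fibre product of totally bounded metric spaces. -/
def TBMet.pb {X Y Z : TBMet.{u}} (f : X ⟶ Z) (g : Y ⟶ Z) : TBMet.{u} where
  obj := Met.pb f.hom g.hom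
  property := by
    have hX : TotallyBounded (Set.univ : Set X.obj) := X.property
    have hY : TotallyBounded (Set.univ : Set Y.obj) := Y.property
    have h : TotallyBounded (Set.univ : Set (X.obj × Y.obj)) := by
      refine totallyBounded_iff_ultrafilter.2 fun F _ => ?_
      have h₁ := totallyBounded_iff_ultrafilter.1 hX (F.map Prod.fst) (by simp)
      have h₂ := totallyBounded_iff_ultrafilter.1 hY (F.map Prod.snd) (by simp)
      refine (h₁.prod h₂).mono (Filter.le_prod.2 ⟨?_, ?_⟩)
      · exact Filter.tendsto_map
      · exact Filter.tendsto_map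
    change TotallyBounded (Set.univ : Set {p : X.obj × Y.obj // f.hom p.1 = g.hom p.2})
    rw [← Set.preimage_univ (f := Subtype.val)]
    exact totallyBounded_preimage isUniformEmbedding_subtype_val.isUniformInducing h

/-- The first projection of the fibre product. -/
def TBMet.pbFst {X Y Z : TBMet.{u}} (f : X ⟶ Z) (g : Y ⟶ Z) : TBMet.pb f g ⟶ X where
  hom := Met.pbFst f.hom g.hom

/-- The second projection of the fibre product. -/
def TBMet.pbSnd {X Y Z : TBMet.{u}} (f : X ⟶ Z) (g : Y ⟶ Z) : TBMet.pb f g ⟶ Y where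
  hom := Met.pbSnd f.hom g.hom

lemma TBMet.pb_condition {X Y Z : TBMet.{u}} (f : X ⟶ Z) (g : Y ⟶ Z) :
    TBMet.pbFst f g ≫ f = TBMet.pbSnd f g ≫ g :=
  InducedCategory.hom_ext (Met.hom_ext fun q => q.2)

/-- The universal property of the fibre product. -/
def TBMet.pbLift {W X Y Z : TBMet.{u}} {f : X ⟶ Z} {g : Y ⟶ Z} (a : W ⟶ X) (b : W ⟶ Y)
    (h : a ≫ f = b ≫ g) : W ⟶ TBMet.pb f g where
  hom := Met.mkHom (fun x => ⟨(a.hom x, b.hom x), Met.congr (congrArg (fun k => k.hom) h) x⟩)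
    fun _ _ => max_le (Met.dist_map_le _ _ _) (Met.dist_map_le _ _ _)

/-! ### Effectiveness of descent data -/

namespace DescentDatum

variable {n : ℕ} {X : TBMet.{u}} {I : Type u} {U : I → TBMet.{u}} {f : ∀ i, U i ⟶ X}
  (D : DescentDatum (GH.{u} n) U f)

open GH

/-- The family underlying an object of a descent datum. -/
abbrev famAt (i : I) : Fam n (U i).obj := fam (D.x i).1 (D.x i).2

/-- The universal gluing morphism between two members of a descent datum. -/
noncomputable def univ (i j : I) :
    pull (D.x i) (TBMet.pbFst (f i) (f j)) ⟶ (D.x j).1 :=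
  D.glue i j (pull (D.x i) (TBMet.pbFst (f i) (f j))) (TBMet.pbFst (f i) (f j))
    (TBMet.pbSnd (f i) (f j)) (TBMet.pb_condition _ _) (pullHom (D.x i) _)
    (isHomLift_pullHom (D.x i) _)

lemma isCart_univ (i j : I) : ((D.famAt i).pullback (TBMet.pbFst (f i) (f j)).hom).IsCart
    (D.famAt j) (tot (D.univ i j)) (TBMet.pbSnd (f i) (f j)).hom :=
  isCart_of_isHomLift (x := pull (D.x i) (TBMet.pbFst (f i) (f j))) rfl (D.x j).2 _
    (D.glue_lift _ _ _ _ _ _ _ _)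

/-- The gluing map on points. -/
noncomputable def trans (i j : I) (p : (D.famAt i).P) (v : (U j).obj)
    (h : (f i).hom ((D.famAt i).p p) = (f j).hom v) : (D.famAt j).P :=
  tot (D.univ i j) (pullPt (D.x i) (TBMet.pbFst (f i) (f j)) p ⟨((D.famAt i).p p, v), h⟩ rfl)

lemma glue_congr {i j : I} {z : (GH n).obj} {b₁ b₁' : (GH n).p.obj z ⟶ U i}
    {b₂ b₂' : (GH n).p.obj z ⟶ U j} {h h'} {a a' : z ⟶ (D.x i).1} {ha ha'} (e₁ : b₁ = b₁')
    (e₂ : b₂ = b₂') (e : a = a') : D.glue i j z b₁ b₂ h a ha = D.glue i j z b₁' b₂' h' a' ha' := by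
  subst e₁ e₂ e
  rfl

/-- Every `a` factors through the pullback of `D.x i` to the fibre product of `U i` and `U j`, so
all gluing maps come from the universal one and amount to a transport of points. -/
lemma tot_glue (i j : I) (z : (GH n).obj) (b₁ : (GH n).p.obj z ⟶ U i) (b₂ : (GH n).p.obj z ⟶ U j)
    (h : b₁ ≫ f i = b₂ ≫ f j) (a : z ⟶ (D.x i).1) (ha : (GH n).p.IsHomLift b₁ a) (q : total z) :
    ∃ h', tot (D.glue i j z b₁ b₂ h a ha) q =
      D.trans i j (tot a q) (b₂.hom ((fam z rfl).p q)) h' := by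
  let k : (GH n).p.obj z ⟶ TBMet.pb (f i) (f j) := TBMet.pbLift b₁ b₂ h
  obtain ⟨c, hc, hca, hcq⟩ := exists_factor_pull (D.x i) (TBMet.pbFst (f i) (f j)) (z := z) rfl
    b₁ a ha k rfl
  have hk : k = (GH n).p.map c :=
    @IsHomLift.eq_of_isHomLift _ _ _ _ (GH n).p z (pull (D.x i) _) k c hc
  have e₁ : (GH n).p.map c ≫ TBMet.pbFst (f i) (f j) = b₁ := by rw [← hk]; rfl
  have e₂ : (GH n).p.map c ≫ TBMet.pbSnd (f i) (f j) = b₂ := by rw [← hk]; rfl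
  have h₀ : ((GH n).p.map c ≫ TBMet.pbFst (f i) (f j)) ≫ f i =
      ((GH n).p.map c ≫ TBMet.pbSnd (f i) (f j)) ≫ f j := by rw [e₁, e₂, h]
  have ha₀ : (GH n).p.IsHomLift ((GH n).p.map c ≫ TBMet.pbFst (f i) (f j))
      (c ≫ pullHom (D.x i) (TBMet.pbFst (f i) (f j))) := by rwa [hca, e₁]
  have key := D.glue_comp i j _ z c (TBMet.pbFst (f i) (f j)) (TBMet.pbSnd (f i) (f j))
    (TBMet.pb_condition _ _) (pullHom (D.x i) _) (isHomLift_pullHom (D.x i) _) h₀ ha₀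
  have key' : D.glue i j z b₁ b₂ h a ha = c ≫ D.univ i j :=
    (D.glue_congr e₁.symm e₂.symm hca.symm).trans key
  obtain ⟨h₁, e⟩ := hcq q
  have hp : (D.famAt i).p (tot a q) = b₁.hom ((fam z rfl).p q) :=
    (isCart_of_isHomLift rfl (D.x i).2 a ha).comm q
  have h' : (f i).hom ((D.famAt i).p (tot a q)) = (f j).hom (b₂.hom ((fam z rfl).p q)) := by
    rw [hp]
    exact Met.congr (congrArg (fun k => k.hom) h) _
  refine ⟨h', ?_⟩
  rw [key', tot_comp_apply, e]
  refine congrArg (tot (D.univ i j)) (Subtype.ext (Prod.ext rfl (Subtype.ext (Prod.ext ?_ rfl))))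
  exact hp.symm

/-- The gluing of families given by a descent datum. -/
noncomputable def gluing : Fam.Gluing (fun i => (f i).hom) D.famAt := by
  have p_trans : ∀ i j p v h, (D.famAt j).p (D.trans i j p v h) = v := fun i j p v h =>
    (D.isCart_univ i j).comm _
  have dist_trans : ∀ i j p p' v v' h h', dist p p' ≤ max (dist (D.trans i j p v h)
      (D.trans i j p' v' h')) (max (dist ((D.famAt i).p p) ((D.famAt i).p p')) (dist v v')) :=
    fun i j p p' v v' h h' => (le_max_left _ _).trans ((D.isCart_univ i j).dist_le
      (pullPt (D.x i) (TBMet.pbFst (f i) (f j)) p ⟨((D.famAt i).p p, v), h⟩ rfl)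
      (pullPt (D.x i) (TBMet.pbFst (f i) (f j)) p' ⟨((D.famAt i).p p', v'), h'⟩ rfl))
  have cocycle : ∀ i j k p v w h h' h'', D.trans j k (D.trans i j p v h) w h' =
      D.trans i k p w h'' := by
    intro i j k p v w h h' h''
    -- The identity concerns the single point `p`, so the cocycle condition is tested on the fibre
    -- through `p`.
    let g : pt ⟶ U i := ptMap ((D.famAt i).p p)
    let q : total (pull (D.x i) g) := pullPt (D.x i) g p PUnit.unit rfl
    have hq : tot (pullHom (D.x i) g) q = p := tot_pullHom_pullPt _ _ _ _ _
    have h₁₂ : g ≫ f i = ptMap v ≫ f j := InducedCategory.hom_ext (Met.hom_ext fun _ => h)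
    have h₁₃ : g ≫ f i = ptMap w ≫ f k := InducedCategory.hom_ext (Met.hom_ext fun _ => h'')
    have h₂₃ : ptMap v ≫ f j = ptMap w ≫ f k := h₁₂.symm.trans h₁₃
    have key := D.cocycle i j k (pull (D.x i) g) g (ptMap v) (ptMap w) h₁₂ h₂₃ h₁₃
      (pullHom (D.x i) g) (isHomLift_pullHom (D.x i) g)
    have key := Met.congr (congrArg tot key) q
    obtain ⟨_, e₁⟩ := D.tot_glue j k (pull (D.x i) g) (ptMap v) (ptMap w) h₂₃
      (D.glue i j (pull (D.x i) g) g (ptMap v) h₁₂ (pullHom (D.x i) g)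
        (isHomLift_pullHom (D.x i) g)) (D.glue_lift _ _ _ _ _ _ _ _) q
    obtain ⟨_, e₂⟩ := D.tot_glue i j (pull (D.x i) g) g (ptMap v) h₁₂ (pullHom (D.x i) g)
      (isHomLift_pullHom (D.x i) g) q
    obtain ⟨_, e₃⟩ := D.tot_glue i k (pull (D.x i) g) g (ptMap w) h₁₃ (pullHom (D.x i) g)
      (isHomLift_pullHom (D.x i) g) q
    rw [e₁, e₃] at key
    simp only [e₂, hq] at key
    exact key
  exact
    { τ := D.trans
      p_τ := p_trans
      dist_τ_le := fun i j p p' v v' h h' => by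
        refine (Met.dist_map_le (tot (D.univ i j)) _ _).trans
          (max_le (le_max_left _ _) (max_le ?_ (le_max_right _ _)))
        exact (Met.dist_map_le (D.famAt i).p _ _).trans (le_max_left _ _)
      cocycle := cocycle
      -- By the cocycle condition, transporting twice equals transporting once, and `dist_trans`
      -- makes transport injective on a fibre; hence it is the identity.
      τ_self := fun i p h => by
        have h₁ : (f i).hom ((D.famAt i).p (D.trans i i p ((D.famAt i).p p) h)) =
          (f i).hom ((D.famAt i).p p) := by rw [p_trans]
        have := dist_trans i i _ _ _ _ h₁ h
        rw [cocycle i i i p _ _ h h₁ h, p_trans, dist_self, dist_self, max_self] at this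
        exact dist_le_zero.1 (by simpa using this)
      τ_s := fun i j l u v h => by
        have h' : (f i).hom u = (f j).hom v := by rw [← h, (D.famAt i).p_s]
        refine Eq.trans ?_ ((D.isCart_univ i j).sec l ⟨(u, v), h'⟩)
        refine congrArg (tot (D.univ i j)) (Subtype.ext (Prod.ext rfl
          (Subtype.ext (Prod.ext ?_ rfl))))
        exact (D.famAt i).p_s l u }

theorem isEffective_GH (hf : IsLsmCovering U f) : D.IsEffective := by
  obtain ⟨B, t, ht, htτ⟩ := Fam.Gluing.exists_glued hf.covers D.gluing
  choose ψ hψ hψt using fun i => exists_hom_of_isCart (y := ofFam B) (D.x i).2 rfl (ht i)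
  refine ⟨⟨ofFam B, rfl⟩, ψ, hψ, fun i j z b₁ b₂ h a ha => ?_⟩
  have h₁ : (GH n).p.IsHomLift (b₂ ≫ f j) (D.glue i j z b₁ b₂ h a ha ≫ ψ j) := by
    have := D.glue_lift i j z b₁ b₂ h a ha
    exact @IsHomLift.comp _ _ _ _ (GH n).p _ _ _ _ _ _ _ _ _ _ this (hψ j)
  have h₂ : (GH n).p.IsHomLift (b₂ ≫ f j) (a ≫ ψ i) := by
    rw [← h]
    exact @IsHomLift.comp _ _ _ _ (GH n).p _ _ _ _ _ _ _ _ _ _ ha (hψ i)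
  refine hom_ext_of_isHomLift h₁ h₂ fun q => ?_
  obtain ⟨h', e⟩ := D.tot_glue i j z b₁ b₂ h a ha q
  rw [tot_comp_apply, tot_comp_apply, e, hψt, hψt]
  exact htτ i j _ _ _

end DescentDatum

theorem isStackInGroupoids_GH (n : ℕ) : IsStackInGroupoids (GH.{u} n) :=
  ⟨isFiberedInGroupoids_GH n, fun _ _ _ _ hf =>
    ⟨isomIsSheafFor_GH hf, fun D => D.isEffective_GH hf⟩⟩


/-! ## Equivalences over a base -/

section Equivalence

variable {C : Type w} [Category.{v} C] {𝒲 𝒳 𝒴 𝒵 : BasedCategory.{u, u + 1} C}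

/-- Every object of the target receives an isomorphism over an identity from the image. -/
def IsVerticallyEssSurj (F : 𝒳 ⟶ 𝒴) : Prop :=
  ∀ y : 𝒴.obj, ∃ (x : 𝒳.obj) (φ : F.obj x ⟶ y), IsIso φ ∧ 𝒴.p.IsHomLift (𝟙 (𝒴.p.obj y)) φ

/-- The natural isomorphism underlying an isomorphism of morphisms of categories over `C`. -/
def toNatIso {F G : 𝒳 ⟶ 𝒴} (α : F ≅ G) : F.toFunctor ≅ G.toFunctor :=
  (BasedNatTrans.forgetful 𝒳 𝒴).mapIso α

lemma isIso_app {F G : 𝒳 ⟶ 𝒴} (α : F ≅ G) (x : 𝒳.obj) : IsIso (α.hom.app x) :=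
  inferInstanceAs (IsIso ((toNatIso α).app x).hom)

/-- A natural transformation over the base with invertible components is invertible. -/
lemma exists_iso_of_app {F G : 𝒳 ⟶ 𝒴} (τ : ∀ x, F.obj x ⟶ G.obj x)
    (hτ : ∀ x y (φ : x ⟶ y), F.map φ ≫ τ y = τ x ≫ G.map φ) (hi : ∀ x, IsIso (τ x))
    (hl : ∀ x, 𝒴.p.IsHomLift (𝟙 (𝒳.p.obj x)) (τ x)) :
    ∃ α : F ≅ G, ∀ x, α.hom.app x = τ x := by
  let α : F.toFunctor ≅ G.toFunctor :=
    NatIso.ofComponents (fun x => @asIso _ _ _ _ (τ x) (hi x)) fun {x y} φ => hτ x y φ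
  exact ⟨BasedNatIso.mkNatIso α hl, fun x => rfl⟩

/-- The quasi-inverse is built from chosen preimages `g y` and isomorphisms `φ y`. As these lie over
identities, it commutes strictly with the projections to `C`. -/
theorem isBasedEquivalence_of {F : 𝒳 ⟶ 𝒴} (hfull : F.toFunctor.Full)
    (hfaith : F.toFunctor.Faithful) (hs : IsVerticallyEssSurj F) : IsBasedEquivalence F := by
  choose g φ hi hl using hs
  have hg : ∀ y, 𝒳.p.obj (g y) = 𝒴.p.obj y := fun y =>
    (F.w_obj (g y)).symm.trans (IsHomLift.domain_eq 𝒴.p (𝟙 _) (φ y))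
  let G₀ : 𝒴.obj ⥤ 𝒳.obj :=
    { obj := g
      map := fun {y y'} ψ => F.toFunctor.preimage (φ y ≫ ψ ≫ inv (φ y'))
      map_id := fun y => F.toFunctor.map_injective (by simp)
      map_comp := fun ψ ψ' => F.toFunctor.map_injective (by simp) }
  have hG₀ : ∀ {y y'} (ψ : y ⟶ y'), F.map (G₀.map ψ) = φ y ≫ ψ ≫ inv (φ y') := fun ψ =>
    F.toFunctor.map_preimage _
  have hGl : ∀ {y y'} (ψ : y ⟶ y'), 𝒳.p.IsHomLift (𝒴.p.map ψ) (G₀.map ψ) := fun {y y'} ψ => by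
    have h : 𝒴.p.IsHomLift (𝒴.p.map ψ) (F.map (G₀.map ψ)) := by
      rw [hG₀]
      have := hl y
      have h₁ := hl y'
      have := IsHomLift.lift_id_inv_isIso 𝒴.p (𝒴.p.obj y') (φ y')
      infer_instance
    exact BasedFunctor.isHomLift_map F _ _
  let G : 𝒴 ⟶ 𝒳 :=
    { toFunctor := G₀
      w := CategoryTheory.Functor.ext hg fun y y' ψ => by
        have := hGl ψ
        exact IsHomLift.fac' 𝒳.p (𝒴.p.map ψ) (G₀.map ψ) }
  have hGφ : ∀ {y y'} (ψ : y ⟶ y'), F.map (G₀.map ψ) ≫ φ y' = φ y ≫ ψ := fun ψ => by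
    rw [hG₀]
    simp
  let θ : ∀ x, g (F.obj x) ⟶ x := fun x => F.toFunctor.preimage (φ (F.obj x))
  have hθ : ∀ x, F.map (θ x) = φ (F.obj x) := fun x => F.toFunctor.map_preimage _
  refine ⟨G, ?_, ?_⟩
  · obtain ⟨α, -⟩ := exists_iso_of_app (F := F ≫ G) (G := 𝟙 𝒳) θ
      (fun x y ψ => F.toFunctor.map_injective (by
        refine (F.toFunctor.map_comp _ _).trans (Eq.trans ?_ (F.toFunctor.map_comp _ _).symm)
        exact (congrArg _ (hθ y)).trans ((hGφ (F.map ψ)).trans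
          (congrArg (fun k => k ≫ F.map ψ) (hθ x).symm))))
      (fun x => by
        have : IsIso (F.toFunctor.map (θ x)) := by
          rw [hθ]
          exact hi _
        exact isIso_of_fully_faithful F.toFunctor (θ x))
      (fun x => by
        have : 𝒴.p.IsHomLift (𝟙 (𝒳.p.obj x)) (F.map (θ x)) := by
          rw [hθ, ← F.w_obj x]
          exact hl _
        exact BasedFunctor.isHomLift_map F _ (θ x))
    exact ⟨α⟩
  · obtain ⟨α, -⟩ := exists_iso_of_app (F := G ≫ F) (G := 𝟙 𝒴) φ (fun y y' ψ => hGφ ψ) hi hl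
    exact ⟨α⟩

lemma IsBasedEquivalence.isEquivalence {F : 𝒳 ⟶ 𝒴} (h : IsBasedEquivalence F) :
    F.toFunctor.IsEquivalence := by
  obtain ⟨G, ⟨η⟩, ⟨ε⟩⟩ := h
  exact (CategoryTheory.Equivalence.mk F.toFunctor G.toFunctor (toNatIso η).symm
    (toNatIso ε)).isEquivalence_functor

lemma IsBasedEquivalence.isVerticallyEssSurj {F : 𝒳 ⟶ 𝒴} (h : IsBasedEquivalence F) :
    IsVerticallyEssSurj F := by
  obtain ⟨G, -, ⟨ε⟩⟩ := h
  exact fun y => ⟨G.obj y, ε.hom.app y, isIso_app ε y, ε.hom.isHomLift' y⟩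

/-- If `𝒳` is fibred in preorders, then every morphism from `𝒳` is faithful. -/
lemma faithful_of_faithful_base (F : 𝒳 ⟶ 𝒴) (h : 𝒳.p.Faithful) : F.toFunctor.Faithful := by
  have : (F.toFunctor ⋙ 𝒴.p).Faithful := by rwa [F.w]
  exact Functor.Faithful.of_comp F.toFunctor 𝒴.p

lemma faithful_base_of_faithful (F : 𝒳 ⟶ 𝒴) (h : F.toFunctor.Faithful) (h' : 𝒴.p.Faithful) :
    𝒳.p.Faithful := by
  rw [← F.w]
  infer_instance

lemma isIso_twoFib {f : 𝒳 ⟶ 𝒵} {g : 𝒴 ⟶ 𝒵} {a b : TwoFib f g} (φ : a ⟶ b)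
    (h₁ : IsIso (TwoFib.Hom.fst φ)) (h₂ : IsIso (TwoFib.Hom.snd φ)) : IsIso φ := by
  let ψ : TwoFib.Hom b a :=
    { fst := inv (TwoFib.Hom.fst φ)
      snd := inv (TwoFib.Hom.snd φ)
      lift := by
        have := TwoFib.Hom.lift φ
        rw [Functor.map_inv]
        exact IsHomLift.inv 𝒴.p (𝒳.p.map (TwoFib.Hom.fst φ)) (TwoFib.Hom.snd φ)
      comm := by
        have := TwoFib.Hom.comm φ
        rw [Functor.map_inv, Functor.map_inv, IsIso.inv_comp_eq, ← Category.assoc, this,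
          Category.assoc, IsIso.hom_inv_id, Category.comp_id] }
  exact ⟨ψ, TwoFib.Hom.ext (IsIso.hom_inv_id _) (IsIso.hom_inv_id _),
    TwoFib.Hom.ext (IsIso.inv_hom_id _) (IsIso.inv_hom_id _)⟩

/-- A criterion for a 2-commutative square to be 2-Cartesian, in terms of morphisms. -/
theorem isTwoCartesian_of {f : 𝒳 ⟶ 𝒵} {g : 𝒴 ⟶ 𝒵} {F : 𝒲 ⟶ 𝒳} {G : 𝒲 ⟶ 𝒴}
    (α : F ≫ f ≅ G ≫ g) (hFG : F.toFunctor.Faithful ∨ G.toFunctor.Faithful)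
    (hfull : ∀ (x y : 𝒲.obj) (b : 𝒲.p.obj x ⟶ 𝒲.p.obj y) (φ₁ : F.obj x ⟶ F.obj y)
      (φ₂ : G.obj x ⟶ G.obj y), 𝒳.p.IsHomLift b φ₁ → 𝒴.p.IsHomLift b φ₂ →
      f.map φ₁ ≫ α.hom.app y = α.hom.app x ≫ g.map φ₂ → ∃ ψ : x ⟶ y, F.map ψ = φ₁ ∧ G.map ψ = φ₂)
    (hs : ∀ (x : 𝒳.obj) (y : 𝒴.obj), 𝒴.p.obj y = 𝒳.p.obj x → ∀ i : f.obj x ≅ g.obj y,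
      𝒵.p.IsHomLift (𝟙 (𝒳.p.obj x)) i.hom → ∃ (w : 𝒲.obj) (φ₁ : F.obj w ⟶ x) (φ₂ : G.obj w ⟶ y),
        IsIso φ₁ ∧ IsIso φ₂ ∧ 𝒳.p.IsHomLift (𝟙 (𝒳.p.obj x)) φ₁ ∧
        𝒴.p.IsHomLift (𝟙 (𝒳.p.obj x)) φ₂ ∧ f.map φ₁ ≫ i.hom = α.hom.app w ≫ g.map φ₂) :
    IsTwoCartesian α := by
  refine isBasedEquivalence_of ⟨fun {x y} φ => ?_⟩ ⟨fun {x y} φ ψ h => ?_⟩ fun a => ?_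
  · have hb : 𝒳.p.IsHomLift (𝒳.p.map (TwoFib.Hom.fst φ)) (TwoFib.Hom.fst φ) := inferInstance
    have hb' := TwoFib.Hom.lift φ
    obtain ⟨ψ, h₁, h₂⟩ := hfull x y
      (eqToHom (F.w_obj x).symm ≫ 𝒳.p.map (TwoFib.Hom.fst φ) ≫ eqToHom (F.w_obj y))
      (TwoFib.Hom.fst φ) (TwoFib.Hom.snd φ)
      ((IsHomLift.lift_eqToHom_comp_iff 𝒳.p _ _ _).2
        ((IsHomLift.lift_comp_eqToHom_iff 𝒳.p _ _ _).2 hb))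
      ((IsHomLift.lift_eqToHom_comp_iff 𝒴.p _ _ _).2
        ((IsHomLift.lift_comp_eqToHom_iff 𝒴.p _ _ _).2 hb'))
      (TwoFib.Hom.comm φ)
    exact ⟨ψ, TwoFib.Hom.ext h₁ h₂⟩
  · rcases hFG with hF | hG
    · exact F.toFunctor.map_injective (congrArg TwoFib.Hom.fst h)
    · exact G.toFunctor.map_injective (congrArg TwoFib.Hom.snd h)
  · obtain ⟨w, φ₁, φ₂, hi₁, hi₂, h₁, h₂, e⟩ := hs (TwoFib.fst a) (TwoFib.snd a)
      (TwoFib.base_eq a) (TwoFib.iso a) (TwoFib.iso_lift a)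
    have hφ : 𝒴.p.IsHomLift (𝒳.p.map φ₁) φ₂ := by
      rw [IsHomLift.fac' 𝒳.p (𝟙 (𝒳.p.obj (TwoFib.fst a))) φ₁]
      infer_instance
    let φ : TwoFib.Hom ((twoFibLift α).obj w) a := ⟨φ₁, φ₂, hφ, e⟩
    refine ⟨w, φ, isIso_twoFib φ hi₁ hi₂, ?_⟩
    have hw : 𝒳.p.obj (F.obj w) = 𝒳.p.obj (TwoFib.fst a) :=
      IsHomLift.domain_eq 𝒳.p (𝟙 (𝒳.p.obj (TwoFib.fst a))) φ₁
    refine IsHomLift.of_fac' (twoFib f g).p _ _ hw rfl ?_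
    exact IsHomLift.fac' 𝒳.p (𝟙 (𝒳.p.obj (TwoFib.fst a))) φ₁

end Equivalence


/-! ## Metric spaces as categories over totally bounded spaces -/

namespace ofMet

variable {U : Met.{u}}

/-- The object given by a map. -/
def mk {S : TBMet.{u}} (h : S.obj ⟶ U) : (ofMet U).obj :=
  CostructuredArrow.mk (S := incl) (Y := S) h

/-- The map underlying an object over `S`. -/
def val (x : (ofMet U).obj) {S : TBMet.{u}} (h : (ofMet U).p.obj x = S) : S.obj ⟶ U :=
  (eqToHom h.symm).hom ≫ Comma.hom x

variable {x y : (ofMet U).obj} {S S' : TBMet.{u}} {b : S ⟶ S'}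

lemma val_of_isHomLift (hx : (ofMet U).p.obj x = S) (hy : (ofMet U).p.obj y = S') (φ : x ⟶ y)
    (h : (ofMet U).p.IsHomLift b φ) (s : S.obj) : val y hy (b.hom s) = val x hx s := by
  subst hx hy
  obtain rfl := IsHomLift.eq_of_isHomLift (ofMet U).p b φ
  exact Met.congr (CostructuredArrow.w φ) s

lemma exists_hom (hx : (ofMet U).p.obj x = S) (hy : (ofMet U).p.obj y = S')
    (h : ∀ s, val y hy (b.hom s) = val x hx s) :
    ∃ φ : x ⟶ y, (ofMet U).p.IsHomLift b φ := by
  subst hx hy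
  let φ : x ⟶ y := CostructuredArrow.homMk b (Met.hom_ext h)
  exact ⟨φ, IsHomLift.map (ofMet U).p φ⟩

instance : (ofMet U).p.Faithful := inferInstanceAs (CostructuredArrow.proj incl.{u} U).Faithful

lemma allCartesian (U : Met.{u}) : AllCartesian (ofMet U) := by
  intro x y φ
  refine ⟨fun {z} g χ hχ => ?_⟩
  have h₁ := fun s => val_of_isHomLift rfl rfl φ (IsHomLift.map (ofMet U).p φ) s
  obtain ⟨ψ, hψ⟩ := exists_hom (x := z) (y := x) (b := g) rfl rfl fun s =>
    (h₁ _).symm.trans (val_of_isHomLift rfl rfl χ hχ s)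
  obtain rfl := IsHomLift.eq_of_isHomLift (ofMet U).p g ψ
  refine ⟨ψ, ⟨hψ, (ofMet U).p.map_injective ?_⟩, fun ψ' ⟨h, _⟩ => (ofMet U).p.map_injective ?_⟩
  · rw [Functor.map_comp]
    exact IsHomLift.eq_of_isHomLift (ofMet U).p _ χ
  · exact (IsHomLift.eq_of_isHomLift (ofMet U).p _ ψ').symm

lemma val_congr {S : TBMet.{u}} (h : (ofMet U).p.obj x = S) (h' : (ofMet U).p.obj y = S)
    (φ : x ⟶ y) (hφ : (ofMet U).p.IsHomLift (𝟙 S) φ) (s : S.obj) : val y h' s = val x h s :=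
  val_of_isHomLift h h' φ hφ s

lemma hom_ext_of_isHomLift {φ ψ : x ⟶ y} (h : (ofMet U).p.IsHomLift b φ)
    (h' : (ofMet U).p.IsHomLift b ψ) : φ = ψ := by
  refine (ofMet U).p.map_injective ?_
  rw [IsHomLift.fac' (ofMet U).p b φ, IsHomLift.fac' (ofMet U).p b ψ]

/-- The morphism from an object to the universal object. -/
def toId {T : TBMet.{u}} (g : (ofMet T.obj).obj) : g ⟶ mk (𝟙 T.obj) :=
  CostructuredArrow.homMk (S := incl) (f := g) (f' := CostructuredArrow.mk (𝟙 T.obj))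
    ⟨Comma.hom g⟩ rfl

lemma comp_toId {T : TBMet.{u}} {g g' : (ofMet T.obj).obj} (φ : g ⟶ g') :
    φ ≫ toId g' = toId g :=
  CostructuredArrow.hom_ext _ _ (InducedCategory.hom_ext (CostructuredArrow.w φ))

lemma isHomLift_toId {T : TBMet.{u}} (g : (ofMet T.obj).obj) :
    (ofMet T.obj).p.IsHomLift (⟨val g rfl⟩ : (ofMet T.obj).p.obj g ⟶ T) (toId g) :=
  IsHomLift.map (ofMet T.obj).p (toId g)

end ofMet

section

variable {𝒲 : BasedCategory.{u, u + 1} TBMet.{u}} {U V : Met.{u}}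

/-- The map underlying the value at `w` of a morphism to a metric space. -/
def valAt (F : 𝒲 ⟶ ofMet U) (w : 𝒲.obj) : (𝒲.p.obj w).obj ⟶ U := ofMet.val (F.obj w) (F.w_obj w)

lemma valAt_map (F : 𝒲 ⟶ ofMet U) {w w' : 𝒲.obj} (φ : w ⟶ w') (s : (𝒲.p.obj w).obj) :
    valAt F w' ((𝒲.p.map φ).hom s) = valAt F w s :=
  ofMet.val_of_isHomLift (F.w_obj w) (F.w_obj w') (F.map φ)
    (BasedFunctor.preserves_isHomLift F _ _) s

lemma valAt_congr {F G : 𝒲 ⟶ ofMet U} (α : F ≅ G) (w : 𝒲.obj) (s : (𝒲.p.obj w).obj) :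
    valAt F w s = valAt G w s :=
  (ofMet.val_congr (F.w_obj w) (G.w_obj w) (α.hom.app w) (α.hom.isHomLift' w) s).symm

/-- A morphism from a totally bounded space is determined by its value at the identity. -/
lemma valAt_eq {T : TBMet.{u}} (F : ofMet T.obj ⟶ ofMet U) (g : (ofMet T.obj).obj)
    (s : ((ofMet T.obj).p.obj g).obj) :
    valAt F g s = valAt F (ofMet.mk (𝟙 T.obj)) (ofMet.val g rfl s) :=
  (valAt_map F (ofMet.toId g) s).symm

/-- Two morphisms to a metric space with the same underlying maps are isomorphic. -/
lemma exists_iso_of_valAt {F G : 𝒲 ⟶ ofMet U} (h : ∀ w s, valAt F w s = valAt G w s) :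
    Nonempty (F ≅ G) := by
  choose τ hτ using fun w => ofMet.exists_hom (b := 𝟙 (𝒲.p.obj w)) (F.w_obj w) (G.w_obj w)
    fun s => (h w s).symm
  obtain ⟨α, -⟩ := exists_iso_of_app (F := F) (G := G) τ (fun x y φ =>
    ofMet.hom_ext_of_isHomLift (b := 𝒲.p.map φ) (by have := hτ y; infer_instance)
      (by have := hτ x; infer_instance))
    (fun w => (ofMet.allCartesian U).isIso _ (hτ w)) hτ
  exact ⟨α⟩

end


/-! ### The diagonal family over a total space -/

namespace Fam

variable {n : ℕ} {B B' : Met.{u}}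

/-- Forget the last section. -/
def init (A : Fam (n + 1) B) : Fam n B := ⟨A.P, A.p, A.proper, fun i => A.s i.castSucc,
  fun i => A.p_s i.castSucc⟩

/-- Add a section. -/
def snoc (A : Fam n B) (σ : B ⟶ A.P) (hσ : ∀ b, A.p (σ b) = b) : Fam (n + 1) B where
  P := A.P
  p := A.p
  proper := A.proper
  s := Fin.snoc (α := fun _ => B ⟶ A.P) A.s σ
  p_s := Fin.lastCases (by simpa using hσ) (fun j => by simpa using A.p_s j)

lemma snoc_castSucc (A : Fam n B) (σ : B ⟶ A.P) (hσ : ∀ b, A.p (σ b) = b) (i : Fin n) :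
    (A.snoc σ hσ).s i.castSucc = A.s i := Fin.snoc_castSucc (α := fun _ => B ⟶ A.P) _ _ _

lemma snoc_last (A : Fam n B) (σ : B ⟶ A.P) (hσ : ∀ b, A.p (σ b) = b) :
    (A.snoc σ hσ).s (Fin.last n) = σ := Fin.snoc_last (α := fun _ => B ⟶ A.P) _ _

lemma isCart_iff_init {A : Fam (n + 1) B} {A' : Fam (n + 1) B'} {t : A.P ⟶ A'.P} {g : B ⟶ B'} :
    A.IsCart A' t g ↔ A.init.IsCart A'.init t g ∧
      ∀ b, t (A.s (Fin.last n) b) = A'.s (Fin.last n) (g b) :=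
  ⟨fun h => ⟨⟨h.comm, h.dist_le, h.exists_lift, fun i => h.sec i.castSucc⟩, h.sec _⟩,
    fun h => ⟨h.1.comm, h.1.dist_le, h.1.exists_lift, Fin.lastCases h.2 h.1.sec⟩⟩

/-- The family over the total space, with the diagonal as the last section. -/
def diag (A : Fam n B) : Fam (n + 1) A.P :=
  (A.pullback A.p).snoc (Met.mkHom (fun q => ⟨(q, q), rfl⟩) fun _ _ => max_le le_rfl le_rfl)
    fun _ => rfl

/-- The first projection of the diagonal family. -/
def diagFst (A : Fam n B) : A.diag.P ⟶ A.P := A.pullbackFst A.p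

lemma diagFst_s_castSucc (A : Fam n B) (i : Fin n) (q : A.P) :
    A.diagFst (A.diag.s i.castSucc q) = A.s i (A.p q) :=
  congrArg (fun k : A.P ⟶ A.diag.P => A.diagFst (k q)) ((A.pullback A.p).snoc_castSucc _ _ i)

lemma diagFst_s_last (A : Fam n B) (q : A.P) :
    A.diagFst (A.diag.s (Fin.last n) q) = q :=
  congrArg (fun k : A.P ⟶ A.diag.P => A.diagFst (k q)) ((A.pullback A.p).snoc_last _ _)

lemma isCart_diagFst (A : Fam n B) : A.diag.init.IsCart A A.diagFst A.p where
  comm x := x.2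
  dist_le x y := (Met.pb_dist x y).le
  exists_lift x b e := ⟨⟨(x, b), e⟩, rfl, rfl⟩
  sec i q := A.diagFst_s_castSucc i q

/-- A section of a family is classified by the diagonal family. -/
lemma exists_isCart_diag (A : Fam n B) (i : Fin n) :
    ∃ t : A.P ⟶ A.diag.P, (A.snoc (A.s i) (A.p_s i)).IsCart A.diag t (A.s i) := by
  -- Since `A.p` composed with `A.s i` is the identity, the identity square of `A` factors through
  -- `diagFst` over `A.s i`.
  obtain ⟨t, ht, ht'⟩ := A.isCart_diagFst.exists_factor (IsCart.id A) (k := A.s i)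
    fun b => (A.p_s i b).symm
  refine ⟨t, isCart_iff_init.2 ⟨⟨ht.comm, ht.dist_le, ht.exists_lift, fun j b => ?_⟩, fun b => ?_⟩⟩
  · rw [← ht.sec]
    exact congrArg (fun k : B ⟶ A.P => t (k b)) (A.snoc_castSucc _ (A.p_s i) j)
  · refine A.isCart_diagFst.eq_of ?_ ((ht.comm _).trans ?_)
    · refine (ht' _).trans ((Met.congr (A.snoc_last _ (A.p_s i)) b).trans ?_)
      exact (A.diagFst_s_last _).symm
    · have h₁ := Met.congr (A.snoc_last (A.s i) (A.p_s i)) b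
      refine (congrArg (fun q => A.s i (A.p q)) h₁).trans ?_
      rw [A.p_s]
      exact (A.diag.p_s _ _).symm

end Fam

/-! ## Morphisms to `GH_n` -/

section Ev

variable {n : ℕ} {𝒲 𝒱 : BasedCategory.{u, u + 1} TBMet.{u}} {B B' : Met.{u}}

open GH

/-- The morphism `F` to `GH_n` is identified with the pullback of the family `A` along the
maps `k w`. -/
structure Ev (F : 𝒲 ⟶ GH.{u} n) (A : Fam n B) (k : ∀ w, (𝒲.p.obj w).obj ⟶ B) where
  ev : ∀ w, total (F.obj w) ⟶ A.P
  cart : ∀ w, (fam (F.obj w) (F.w_obj w)).IsCart A (ev w) (k w)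
  nat : ∀ {w w'} (φ : w ⟶ w') (q : total (F.obj w)), ev w' (tot (F.map φ) q) = ev w q

namespace Ev

variable {F G : 𝒲 ⟶ GH.{u} n} {A : Fam n B} {k : ∀ w, (𝒲.p.obj w).obj ⟶ B}

/-- Both values at `w` are Cartesian over `A` along the same map, so there is a unique comparison
map between them, and uniqueness gives naturality. -/
lemma exists_iso (E : Ev F A k) {k'} (E' : Ev G A k') (hk : ∀ w s, k w s = k' w s) :
    ∃ α : F ≅ G, ∀ w (q : total (F.obj w)),
      E'.ev w (tot (x := F.obj w) (y := G.obj w) (α.hom.app w) q) = E.ev w q := by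
  choose t ht ht' using fun w => (E'.cart w).exists_factor (E.cart w)
    (k := 𝟙 (𝒲.p.obj w).obj) (hk w)
  choose τ hτ hτt using fun w => exists_hom_of_isCart (x := F.obj w) (y := G.obj w)
    (b := 𝟙 (𝒲.p.obj w)) (F.w_obj w) (G.w_obj w) (ht w)
  have hnat : ∀ w w' (φ : w ⟶ w'), F.map φ ≫ τ w' = τ w ≫ G.map φ := by
    intro w w' φ
    have h₁ : (GH n).p.IsHomLift (𝒲.p.map φ) (F.map φ ≫ τ w') := by
      have := hτ w'
      infer_instance
    have h₂ : (GH n).p.IsHomLift (𝒲.p.map φ) (τ w ≫ G.map φ) := by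
      have := hτ w
      infer_instance
    refine hom_ext_of_isHomLift h₁ h₂ fun q => (E'.cart w').eq_of ?_ ?_
    · rw [tot_comp_apply, tot_comp_apply, hτt, hτt, E'.nat]
      exact (ht' _ _).trans ((E.nat φ q).trans (ht' _ _).symm)
    · exact ((isCart_of_isHomLift (F.w_obj w) (G.w_obj w') _ h₁).comm q).trans
        ((isCart_of_isHomLift (F.w_obj w) (G.w_obj w') _ h₂).comm q).symm
  obtain ⟨α, hα⟩ := exists_iso_of_app τ hnat (fun w => (allCartesian_GH n).isIso _ (hτ w)) hτ
  refine ⟨α, fun w q => ?_⟩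
  rw [hα, hτt]
  exact ht' w q

/-- Precomposition. -/
def precomp (E : Ev F A k) (K : 𝒱 ⟶ 𝒲) :
    Ev (K ≫ F) A fun v => (eqToHom (K.w_obj v).symm).hom ≫ k (K.obj v) where
  ev v := E.ev (K.obj v)
  cart v := by
    have key : ∀ {S : TBMet.{u}} (h : 𝒲.p.obj (K.obj v) = S), (fam (F.obj (K.obj v))
        ((F.w_obj _).trans h)).IsCart A (E.ev (K.obj v)) ((eqToHom h.symm).hom ≫ k (K.obj v)) := by
      rintro S rfl
      exact E.cart (K.obj v)
    exact key (K.w_obj v)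
  nat φ q := E.nat (K.map φ) q

/-- Change of the classified family along a Cartesian square. -/
def postcomp (E : Ev F A k) {A' : Fam n B'} {t : A.P ⟶ A'.P} {g : B ⟶ B'}
    (h : A.IsCart A' t g) : Ev F A' fun w => k w ≫ g where
  ev w := E.ev w ≫ t
  cart w := (E.cart w).comp h
  nat φ q := congrArg t (E.nat φ q)

/-- Forgetting the last section. -/
def forget {F : 𝒲 ⟶ GH.{u} (n + 1)} {A : Fam (n + 1) B} (E : Ev F A k) :
    Ev (F ≫ forgetLast n) A.init k where
  ev := E.ev
  cart w := (Fam.isCart_iff_init.1 (E.cart w)).1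
  nat φ q := E.nat φ q

/-- Repeating a section. -/
def rep (E : Ev F A k) (i : Fin n) :
    Ev (F ≫ repeatSection n i) (A.snoc (A.s i) (A.p_s i)) k where
  ev := E.ev
  cart w := by
    have h := E.cart w
    refine ⟨h.comm, h.dist_le, h.exists_lift, ?_⟩
    refine Fin.lastCases (fun b => ?_) fun j b => ?_
    · rw [Fam.snoc_last, ← h.sec]
      refine congrArg (E.ev w) ?_
      change Fin.snoc (α := fun _ => (GHObj.T (F.obj w)).obj ⟶ GHObj.P (F.obj w))
        (GHObj.s (F.obj w)) (GHObj.s (F.obj w) i) (Fin.last n) _ = _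
      rw [Fin.snoc_last]
      rfl
    · rw [Fam.snoc_castSucc, ← h.sec]
      refine congrArg (E.ev w) ?_
      change Fin.snoc (α := fun _ => (GHObj.T (F.obj w)).obj ⟶ GHObj.P (F.obj w))
        (GHObj.s (F.obj w)) (GHObj.s (F.obj w) i) j.castSucc _ = _
      rw [Fin.snoc_castSucc]
      rfl
  nat φ q := E.nat φ q

/-- Every morphism from a totally bounded space classifies its value at the identity. -/
def ofId {T : TBMet.{u}} (F : ofMet T.obj ⟶ GH.{u} n) :
    Ev F (fam (F.obj (ofMet.mk (𝟙 T.obj))) (F.w_obj _)) fun g => ofMet.val g rfl where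
  ev g := tot (F.map (ofMet.toId g))
  cart g := isCart_of_isHomLift (b := ⟨ofMet.val g rfl⟩) (F.w_obj g) (F.w_obj _) _ (by
    have := ofMet.isHomLift_toId g
    infer_instance)
  nat {g g'} φ q := by
    rw [← tot_comp_apply, ← Functor.map_comp, ofMet.comp_toId]

end Ev

/-- The morphism classifying a family. -/
def cls (A : Fam n B) : ofMet B ⟶ GH.{u} n where
  obj x := ofFam (S := (ofMet B).p.obj x) (A.pullback (ofMet.val x rfl))
  map {x y} φ :=
    let t : Met.pb A.p (ofMet.val x rfl) ⟶ Met.pb A.p (ofMet.val y rfl) :=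
      Met.mkHom (fun q => ⟨(q.1.1, ((ofMet B).p.map φ).hom q.1.2), q.2.trans
        (ofMet.val_of_isHomLift rfl rfl φ (IsHomLift.map _ φ) _).symm⟩)
        fun _ _ => max_le_max le_rfl (Met.dist_map_le _ _ _)
    GHObj.Hom.mk t ((ofMet B).p.map φ) (Met.isPullback_of (fun _ => rfl)
      (fun p q => max_le_max (le_max_left _ _) le_rfl) fun a b h =>
        ⟨⟨(a.1.1, b), by
          have h' : a.1.2 = _ := h
          have := a.2
          rw [h'] at this
          exact this.trans (ofMet.val_of_isHomLift rfl rfl φ (IsHomLift.map _ φ) _)⟩,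
          Subtype.ext (Prod.ext rfl h.symm), rfl⟩)
      fun i => Met.hom_ext fun b => Subtype.ext (Prod.ext (congrArg (A.s i)
        (ofMet.val_of_isHomLift rfl rfl φ (IsHomLift.map _ φ) _).symm) rfl)
  map_id _ := rfl
  map_comp _ _ := rfl
  w := rfl

/-- The morphism classifying a family classifies that family. -/
def Ev.cls (A : Fam n B) : Ev (cls A) A fun g => ofMet.val g rfl where
  ev g := A.pullbackFst (ofMet.val g rfl)
  cart g := A.isCart_pullbackFst (ofMet.val g rfl)
  nat _ _ := rfl

end Ev


/-! ### The classifying squares are 2-Cartesian -/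

section Squares

variable {n : ℕ} {P : BasedCategory.{u, u + 1} TBMet.{u}} {B : Met.{u}}

open GH

instance (n : ℕ) : (forgetLast.{u} n).toFunctor.Faithful where
  map_injective h := by
    have h₁ := congrArg tot h
    have h₂ := congrArg (fun k => (GH n).p.map k) h
    exact GHObj.Hom.ext h₁ h₂

instance (n : ℕ) (i : Fin n) : (repeatSection.{u} n i).toFunctor.Faithful where
  map_injective h := by
    have h₁ := congrArg tot h
    have h₂ := congrArg (fun k => (GH (n + 1)).p.map k) h
    exact GHObj.Hom.ext h₁ h₂

instance (n : ℕ) (i : Fin n) : (repeatSection.{u} n i).toFunctor.Full where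
  map_surjective {x y} φ := by
    let φ' : GHObj.Hom ((GHObj.repeatSection n i).obj x) ((GHObj.repeatSection n i).obj y) := φ
    refine ⟨GHObj.Hom.mk φ'.tot φ'.base φ'.isPullback fun j => ?_, rfl⟩
    have := φ'.s_tot j.castSucc
    change Fin.snoc (α := fun _ => (GHObj.T x).obj ⟶ GHObj.P x) _ _ _ ≫ _ =
      _ ≫ Fin.snoc (α := fun _ => (GHObj.T y).obj ⟶ GHObj.P y) _ _ _ at this
    rwa [Fin.snoc_castSucc, Fin.snoc_castSucc] at this

/-- A morphism between objects over the total space is determined by its base. -/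
lemma exists_map_of_val (val : P ⟶ ofMet B) (hfull : val.toFunctor.Full) {w w' : P.obj}
    {S S' : TBMet.{u}} (hw : P.p.obj w = S) (hw' : P.p.obj w' = S') (b : S ⟶ S')
    (h : ∀ s, ofMet.val (val.obj w') ((val.w_obj w').trans hw') (b.hom s) =
      ofMet.val (val.obj w) ((val.w_obj w).trans hw) s) :
    ∃ ψ : w ⟶ w', P.p.IsHomLift b ψ := by
  obtain ⟨φ, hφ⟩ := ofMet.exists_hom (b := b) ((val.w_obj w).trans hw) ((val.w_obj w').trans hw') h
  obtain ⟨ψ, hψ⟩ := val.toFunctor.map_surjective φ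
  subst hψ
  exact ⟨ψ, BasedFunctor.isHomLift_map val b ψ⟩

lemma val_of_valAt {p : P ⟶ ofMet B} {B' : Met.{u}} {val : P ⟶ ofMet B'} {f : B' ⟶ B}
    (hp : ∀ w s, valAt p w s = f (valAt val w s)) {w : P.obj} {S : TBMet.{u}} (hw : P.p.obj w = S)
    (s : S.obj) : ofMet.val (p.obj w) ((p.w_obj w).trans hw) s =
      f (ofMet.val (val.obj w) ((val.w_obj w).trans hw) s) := by
  subst hw
  exact hp w s

/-- The square given by forgetting the diagonal section is 2-Cartesian. -/
theorem exists_isTwoCartesian_forgetLast {A : Fam n B} (val : P ⟶ ofMet A.P)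
    (hfull : val.toFunctor.Full) (hfaith : val.toFunctor.Faithful) (hval : IsVerticallyEssSurj val)
    (p : P ⟶ ofMet B) (hp : ∀ w s, valAt p w s = A.p (valAt val w s)) (cl : ofMet B ⟶ GH.{u} n)
    (E : Ev cl A fun g => ofMet.val g rfl) :
    ∃ β : (val ≫ cls A.diag) ≫ forgetLast n ≅ p ≫ cl, IsTwoCartesian β := by
  let D : P ⟶ GH.{u} (n + 1) := val ≫ cls A.diag
  let ED := (Ev.cls A.diag).precomp val
  obtain ⟨β, hβ⟩ := (ED.forget.postcomp A.isCart_diagFst).exists_iso (E.precomp p)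
    fun w s => (hp w s).symm
  have hβ' : ∀ w (q : total (D.obj w)), E.ev (p.obj w)
      (tot (x := (D ≫ forgetLast n).obj w) (y := (p ≫ cl).obj w) (β.hom.app w) q) =
        A.diagFst (ED.ev w q) := hβ
  have hlast : ∀ w (s : (P.p.obj w).obj), A.diagFst (ED.ev w
      ((fam (D.obj w) (D.w_obj w)).s (Fin.last n) s)) = valAt val w s := fun w s => by
    rw [(ED.cart w).sec]
    exact A.diagFst_s_last _
  have hPf : P.p.Faithful := faithful_base_of_faithful val hfaith inferInstance
  refine ⟨β, isTwoCartesian_of β (.inr <| faithful_of_faithful_base p hPf)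
    (fun x y b φ₁ φ₂ h₁ h₂ e => ?_) (fun x y hxy i hi => ?_)⟩
  · have H := isCart_of_isHomLift (D.w_obj x) (D.w_obj y) φ₁ h₁
    -- Evaluating `e` on the last section of `D.obj x` shows that `b` is compatible with the maps to
    -- `A.P` attached to `x` and `y`; fullness of `val` then provides `ψ`.
    obtain ⟨ψ, hψ⟩ := exists_map_of_val val hfull rfl rfl b fun s => by
      have e₁ := congrArg (E.ev (p.obj y)) (Met.congr (congrArg tot e)
        ((fam (D.obj x) (D.w_obj x)).s (Fin.last n) s))
      have e₂ : A.diagFst (ED.ev y (tot φ₁ ((fam (D.obj x) (D.w_obj x)).s (Fin.last n) s))) =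
          valAt val x s :=
        (hβ' y _).symm.trans (e₁.trans ((E.nat φ₂ _).trans ((hβ' x _).trans (hlast x s))))
      exact (hlast y (b.hom s)).symm.trans ((congrArg (fun q => A.diagFst (ED.ev y q))
        (H.sec (Fin.last n) s)).symm.trans e₂)
    have e₁ : p.map ψ = φ₂ :=
      ofMet.hom_ext_of_isHomLift (BasedFunctor.preserves_isHomLift p b ψ) h₂
    refine ⟨ψ, (forgetLast n).toFunctor.map_injective ?_, e₁⟩
    have := isIso_app β y
    refine (cancel_mono (β.hom.app y)).1 ?_
    refine Eq.trans ?_ e.symm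
    rw [← e₁]
    exact β.hom.naturality ψ
  · let S := (GH (n + 1)).p.obj x
    have hcart := isCart_of_isHomLift (b := 𝟙 S) (x := (forgetLast n).obj x) (y := cl.obj y)
      rfl ((cl.w_obj y).trans hxy) i.hom hi
    have Ey' : ∀ {S'} (hy : (ofMet B).p.obj y = S'), (fam (cl.obj y)
        ((cl.w_obj y).trans hy)).IsCart A (E.ev y) (ofMet.val y hy) := by
      rintro _ rfl
      exact E.cart y
    have Ey := Ey' hxy
    -- Through `i`, the family of `x` is a pullback of `A`, so its last section becomes a map `h` to
    -- `A.P`. The required object `w` is the one representing `h`.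
    let σ : S.obj ⟶ total x := (fam x rfl).s (Fin.last n)
    let h : S.obj ⟶ A.P := σ ≫ (show total x ⟶ _ from
      tot (x := (forgetLast n).obj x) (y := cl.obj y) i.hom ≫ E.ev y)
    obtain ⟨w, θ, hθi, hθ⟩ := hval (ofMet.mk (U := A.P) h)
    have hθ : (ofMet A.P).p.IsHomLift (𝟙 S) θ := hθ
    have hw : P.p.obj w = S := (val.w_obj w).symm.trans (IsHomLift.domain_eq _ (𝟙 S) θ)
    have hh : ∀ s, ofMet.val (val.obj w) ((val.w_obj w).trans hw) s = h s := fun s =>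
      (ofMet.val_congr ((val.w_obj w).trans hw) (y := ofMet.mk h) rfl θ hθ s).symm
    have hlast' : ∀ {S'} (hw : P.p.obj w = S') s, A.diagFst (ED.ev w ((fam (D.obj w)
        ((D.w_obj w).trans hw)).s (Fin.last n) s)) =
          ofMet.val (val.obj w) ((val.w_obj w).trans hw) s := by
      rintro _ rfl s
      exact hlast w s
    have hσ : ∀ s, A.p (h s) = ofMet.val y hxy s := fun s => by
      refine (Ey.comm _).trans (congrArg (ofMet.val y hxy) ?_)
      exact (hcart.comm _).trans ((fam x rfl).p_s _ _)
    obtain ⟨χ₂, hχ₂⟩ := ofMet.exists_hom (b := 𝟙 S) ((p.w_obj w).trans hw) hxy fun s => by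
      rw [val_of_valAt hp hw, hh]
      exact (hσ s).symm
    let ζ : (D ≫ forgetLast n).obj w ⟶ (forgetLast n).obj x :=
      β.hom.app w ≫ cl.map χ₂ ≫ i.inv
    have hβw : (GH n).p.IsHomLift (𝟙 S) (β.hom.app w) := β.hom.isHomLift hw
    have hζ : (GH n).p.IsHomLift (𝟙 S) ζ := by
      have h₁ : (GH n).p.IsHomLift (𝟙 S) (cl.map χ₂) := inferInstance
      have h₂ : (GH n).p.IsHomLift (𝟙 S) i.inv := IsHomLift.lift_id_inv _ _ i
      have h₃ := @IsHomLift.comp_of_lift_id _ _ _ _ (GH n).p S _ _ _ _ _ h₁ h₂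
      exact @IsHomLift.comp_of_lift_id _ _ _ _ (GH n).p S _ _ _ _ _ hβw h₃
    have hζ' := isCart_of_isHomLift (b := 𝟙 S) (x := (D ≫ forgetLast n).obj w)
      (y := (forgetLast n).obj x) ((D.w_obj w).trans hw) rfl ζ hζ
    have hζi : ζ ≫ i.hom = β.hom.app w ≫ cl.map χ₂ := by
      refine (Category.assoc _ _ _).trans (congrArg (fun k => β.hom.app w ≫ k) ?_)
      exact (Category.assoc _ _ _).trans ((congrArg (fun k => cl.map χ₂ ≫ k) i.inv_hom_id).trans
        (Category.comp_id _))
    -- As a morphism of `GH n`, `ζ` respects the first `n` sections. For the last one, both sides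
    -- have image `h` in `A.P` and the same base point, hence agree.
    obtain ⟨χ₁, hχ₁, hχ₁t⟩ := exists_hom_of_isCart (b := 𝟙 S) (x := D.obj w) (y := x)
      (t := tot (x := (D ≫ forgetLast n).obj w) (y := (forgetLast n).obj x) ζ)
      ((D.w_obj w).trans hw) rfl (Fam.isCart_iff_init.2 ⟨hζ', fun s => by
        have hc := hcart.comp Ey
        refine hc.eq_of ?_ ?_
        · have e₁ := Met.congr (congrArg tot hζi)
            ((fam (D.obj w) ((D.w_obj w).trans hw)).s (Fin.last n) s)
          refine (congrArg (E.ev y) e₁).trans ?_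
          refine (E.nat χ₂ _).trans ((hβ' _ _).trans ?_)
          exact (hlast' hw s).trans (hh s)
        · refine (hζ'.comm _).trans ?_
          refine Eq.trans ?_ ((fam x rfl).p_s _ _).symm
          exact (fam (D.obj w) ((D.w_obj w).trans hw)).p_s (Fin.last n) s⟩)
    have e : (forgetLast n).map χ₁ = ζ :=
      hom_ext_of_isHomLift (b := 𝟙 S) (BasedFunctor.preserves_isHomLift (forgetLast n) (𝟙 S) χ₁) hζ
        fun q => Met.congr hχ₁t q
    exact ⟨w, χ₁, χ₂, (allCartesian_GH _).isIso _ hχ₁, (ofMet.allCartesian _).isIso _ hχ₂, hχ₁, hχ₂,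
      by rw [e]; exact hζi⟩

/-- The square given by repeating a section is 2-Cartesian. -/
theorem exists_isTwoCartesian_repeatSection {A : Fam n B} (val : P ⟶ ofMet A.P)
    (hfull : val.toFunctor.Full) (hfaith : val.toFunctor.Faithful) (p : P ⟶ ofMet B)
    (hp : ∀ w s, valAt p w s = A.p (valAt val w s)) (i : Fin n) (s : ofMet B ⟶ P)
    (hs : ∀ g t, valAt (s ≫ val) g t = A.s i (ofMet.val g rfl t)) :
    ∃ α : cls A ≫ repeatSection n i ≅ s ≫ (val ≫ cls A.diag), IsTwoCartesian α := by
  let D : P ⟶ GH.{u} (n + 1) := val ≫ cls A.diag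
  let ED := (Ev.cls A.diag).precomp val
  obtain ⟨t, ht⟩ := A.exists_isCart_diag i
  obtain ⟨α, -⟩ : ∃ α : cls A ≫ repeatSection n i ≅ s ≫ D, True := by
    obtain ⟨α, -⟩ := (((Ev.cls A).rep i).postcomp ht).exists_iso
      ((Ev.cls A.diag).precomp (s ≫ val)) fun g t => (hs g t).symm
    exact ⟨α, trivial⟩
  have hPf : P.p.Faithful := faithful_base_of_faithful val hfaith inferInstance
  refine ⟨α, isTwoCartesian_of α (.inr <| faithful_of_faithful_base s inferInstance)
    (fun x y b φ₁ φ₂ h₁ h₂ e => ?_) (fun x y hxy j hj => ?_)⟩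
  · obtain ⟨ψ, hψ⟩ := ofMet.exists_hom (x := x) (y := y) (b := b) rfl rfl fun r => by
      have h₃ := ofMet.val_of_isHomLift ((s ≫ val).w_obj x) ((s ≫ val).w_obj y) (val.map φ₂)
        (BasedFunctor.preserves_isHomLift val b φ₂) r
      have h₄ := congrArg A.p ((hs y (b.hom r)).symm.trans (h₃.trans (hs x r)))
      rwa [A.p_s, A.p_s] at h₄
    have e₁ : s.map ψ = φ₂ := by
      have h₃ : P.p.IsHomLift b (s.map ψ) := BasedFunctor.preserves_isHomLift s b ψ
      refine P.p.map_injective ?_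
      rw [IsHomLift.fac' P.p b (s.map ψ), IsHomLift.fac' P.p b φ₂]
    refine ⟨ψ, (repeatSection n i).toFunctor.map_injective ?_, e₁⟩
    have := isIso_app α y
    refine (cancel_mono (α.hom.app y)).1 ?_
    refine Eq.trans ?_ e.symm
    rw [← e₁]
    exact α.hom.naturality ψ
  · let S := (GH n).p.obj x
    let h : S.obj ⟶ A.P := ofMet.val (val.obj y) ((val.w_obj y).trans hxy)
    have hcart := isCart_of_isHomLift (b := 𝟙 S) (x := (repeatSection n i).obj x) (y := D.obj y)
      rfl ((D.w_obj y).trans hxy) j.hom hj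
    have Ey' : ∀ {S'} (hy : P.p.obj y = S'), (fam (D.obj y) ((D.w_obj y).trans hy)).IsCart A.diag
        (ED.ev y) (ofMet.val (val.obj y) ((val.w_obj y).trans hy)) := by
      rintro _ rfl
      exact ED.cart y
    have Ey := hcart.comp (Ey' hxy)
    -- After repetition the last section equals the `i`-th one. In the diagonal family these are the
    -- diagonal and `A.s i` after `A.p`, so `h` factors through the section `A.s i`.
    have hh : ∀ r, A.s i (A.p (h r)) = h r := fun r => by
      have e₁ : (fam ((repeatSection n i).obj x) rfl).s (Fin.last n) r =
          (fam ((repeatSection n i).obj x) rfl).s i.castSucc r := by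
        change Fin.snoc (α := fun _ => (GHObj.T x).obj ⟶ GHObj.P x) (GHObj.s x) (GHObj.s x i)
          (Fin.last n) _ = Fin.snoc (α := fun _ => (GHObj.T x).obj ⟶ GHObj.P x) (GHObj.s x)
            (GHObj.s x i) i.castSucc _
        rw [Fin.snoc_last, Fin.snoc_castSucc]
      have e₂ := (Ey.sec (Fin.last n) r).symm.trans ((congrArg _ e₁).trans (Ey.sec i.castSucc r))
      exact (A.diagFst_s_castSucc i _).symm.trans
        ((congrArg A.diagFst e₂).symm.trans (A.diagFst_s_last _))
    let g : (ofMet B).obj := ofMet.mk (S := S) (ofMet.val (p.obj y) ((p.w_obj y).trans hxy))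
    obtain ⟨χ₂, hχ₂⟩ := exists_map_of_val val hfull (w := s.obj g) (w' := y) (S := S)
      (s.w_obj g) hxy (𝟙 S) fun r => by
        refine Eq.trans ?_ (hs g r).symm
        refine (hh r).symm.trans (congrArg (A.s i) ?_)
        exact (val_of_valAt hp hxy r).symm
    let ζ : (repeatSection n i).obj ((cls A).obj g) ⟶ (repeatSection n i).obj x :=
      α.hom.app g ≫ D.map χ₂ ≫ j.inv
    have hζ : (GH (n + 1)).p.IsHomLift (𝟙 S) ζ := by
      have h₁ : (GH (n + 1)).p.IsHomLift (𝟙 S) (D.map χ₂) :=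
        BasedFunctor.preserves_isHomLift D (𝟙 S) χ₂
      have h₂ : (GH (n + 1)).p.IsHomLift (𝟙 S) j.inv := IsHomLift.lift_id_inv _ _ j
      have h₃ := @IsHomLift.comp_of_lift_id _ _ _ _ (GH (n + 1)).p S _ _ _ _ _ h₁ h₂
      exact @IsHomLift.comp_of_lift_id _ _ _ _ (GH (n + 1)).p S _ _ _ _ _ (α.hom.isHomLift' g) h₃
    have hζj : ζ ≫ j.hom = α.hom.app g ≫ D.map χ₂ := by
      refine (Category.assoc _ _ _).trans (congrArg (fun k => α.hom.app g ≫ k) ?_)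
      exact (Category.assoc _ _ _).trans ((congrArg (fun k => D.map χ₂ ≫ k) j.inv_hom_id).trans
        (Category.comp_id _))
    obtain ⟨χ₁, e⟩ := (repeatSection n i).toFunctor.map_surjective ζ
    have hχ₁ : (GH n).p.IsHomLift (𝟙 S) χ₁ := by
      have : (GH (n + 1)).p.IsHomLift (𝟙 S) ((repeatSection n i).map χ₁) := by rwa [e]
      exact BasedFunctor.isHomLift_map (repeatSection n i) (𝟙 S) χ₁
    have hi : IsIso χ₂ := by
      have : IsIso (val.toFunctor.map χ₂) := (ofMet.allCartesian _).isIso (S := S) _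
        (BasedFunctor.preserves_isHomLift val (𝟙 S) χ₂)
      exact isIso_of_fully_faithful val.toFunctor χ₂
    exact ⟨g, χ₁, χ₂, (allCartesian_GH _).isIso _ hχ₁, hi, hχ₁, hχ₂, by rw [e]; exact hζj⟩

/-- Forgetting the last section is a representable proper submetry. -/
theorem isRepresentableProperSubmetry_forgetLast (n : ℕ) :
    IsRepresentableProperSubmetry (forgetLast.{u} n) := by
  intro T b
  let A : Fam n T.obj := fam (b.obj (ofMet.mk (𝟙 T.obj))) (b.w_obj _)
  -- With `A.P` in the role of `P` and `val` the identity, the square says that the fibre product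
  -- over `T` is `A.P`.
  obtain ⟨β, hβ⟩ := exists_isTwoCartesian_forgetLast (A := A) (𝟙 (ofMet A.P))
    (inferInstanceAs (𝟭 (ofMet A.P).obj).Full) (inferInstanceAs (𝟭 (ofMet A.P).obj).Faithful)
    (fun y => ⟨y, 𝟙 y, @IsIso.id _ _ y, IsHomLift.id rfl⟩) (ofMetMap A.p) (fun _ _ => rfl) b
    (Ev.ofId b)
  exact ⟨A.P, A.p, twoFibLift β, A.proper, hβ, ⟨Iso.refl _⟩⟩

/-- The source of a representable proper submetry to a metric space is a metric space. -/
theorem IsRepresentableProperSubmetry.exists_val {X : TBMet.{u}} {p : P ⟶ ofMet X.obj}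
    (h : IsRepresentableProperSubmetry p) : ∃ (Q : Met.{u}) (f : Q ⟶ X.obj) (val : P ⟶ ofMet Q),
      IsProperSubmetry f ∧ val.toFunctor.Full ∧ val.toFunctor.Faithful ∧
      IsVerticallyEssSurj val ∧ ∀ w s, valAt p w s = f (valAt val w s) := by
  obtain ⟨Q, f, e, hf, ⟨G, ⟨η⟩, ⟨ε⟩⟩, ⟨κ⟩⟩ := h X (𝟙 _)
  -- Representability along the identity of `X` describes the fibre product of `P` with `X` over
  -- `X`, which is now compared with `P`.
  let α : 𝟙 P ≫ p ≅ p ≫ 𝟙 (ofMet X.obj) := Iso.refl p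
  have hα : IsTwoCartesian α := by
    refine isTwoCartesian_of α (.inl (inferInstanceAs (𝟭 P.obj).Faithful))
      (fun x y b φ₁ φ₂ h₁ h₂ e => ⟨φ₁, rfl, ?_⟩) fun x y hxy i hi => ?_
    · exact ofMet.hom_ext_of_isHomLift (BasedFunctor.preserves_isHomLift p b φ₁) h₂
    · refine ⟨x, 𝟙 x, i.hom, @IsIso.id _ _ x, Iso.isIso_hom i, IsHomLift.id rfl, hi, ?_⟩
      exact (congrArg (fun k => k ≫ i.hom) (p.map_id x))
  let L := twoFibLift α
  have hG : IsBasedEquivalence G := ⟨e, ⟨ε⟩, ⟨η⟩⟩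
  have hL : L.toFunctor.IsEquivalence := IsBasedEquivalence.isEquivalence hα
  have hG' := hG.isEquivalence
  have hLG : (L ≫ G).toFunctor.IsEquivalence :=
    inferInstanceAs (L.toFunctor ⋙ G.toFunctor).IsEquivalence
  refine ⟨Q, f, L ≫ G, hf, hLG.full, hLG.faithful, fun y => ?_, fun w s => ?_⟩
  · obtain ⟨z, φ, hi, hφ⟩ := hG.isVerticallyEssSurj y
    obtain ⟨x, ψ, hi', hψ⟩ := IsBasedEquivalence.isVerticallyEssSurj hα z
    have hi'' : IsIso (G.map ψ) := G.toFunctor.map_isIso ψ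
    refine ⟨x, G.map ψ ≫ φ, @IsIso.comp_isIso _ _ _ _ _ _ _ hi'' hi, ?_⟩
    have hz : (twoFib p (𝟙 (ofMet X.obj))).p.obj z = (ofMet Q).p.obj y :=
      (G.w_obj z).symm.trans (IsHomLift.domain_eq _ (𝟙 ((ofMet Q).p.obj y)) φ)
    rw [hz] at hψ
    have : (ofMet Q).p.IsHomLift (𝟙 ((ofMet Q).p.obj y)) (G.map ψ) :=
      BasedFunctor.preserves_isHomLift G _ ψ
    exact @IsHomLift.comp_of_lift_id _ _ _ _ (ofMet Q).p _ _ _ _ _ _ this hφ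
  · have hw : (ofMet Q).p.obj (G.obj (L.obj w)) = P.p.obj w := (L ≫ G).w_obj w
    have h₁ := κ.hom.isHomLift hw
    have h₂ : (twoFib p (𝟙 (ofMet X.obj))).p.IsHomLift (𝟙 (P.p.obj w)) (ε.hom.app (L.obj w)) :=
      ε.hom.isHomLift (L.w_obj w)
    have h₃ : (ofMet X.obj).p.IsHomLift (𝟙 (P.p.obj w))
      ((twoFibSnd p (𝟙 (ofMet X.obj))).map (ε.hom.app (L.obj w))) :=
      BasedFunctor.preserves_isHomLift (twoFibSnd p (𝟙 (ofMet X.obj))) _ _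
    have e₁ := ofMet.val_congr (@IsHomLift.domain_eq _ _ _ _ _ _ _ _ _ _ _ h₁)
      (@IsHomLift.codomain_eq _ _ _ _ _ _ _ _ _ _ _ h₁) _ h₁ s
    have e₂ := ofMet.val_congr (@IsHomLift.domain_eq _ _ _ _ _ _ _ _ _ _ _ h₃)
      (@IsHomLift.codomain_eq _ _ _ _ _ _ _ _ _ _ _ h₃) _ h₃ s
    exact e₂.trans e₁.symm

/-- Families with sections over a totally bounded space are classified by a pair of morphisms. -/
theorem exists_classifying {X : TBMet.{u}} {p : P ⟶ ofMet X.obj}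
    (h : IsRepresentableProperSubmetry p) (s : Fin n → (ofMet X.obj ⟶ P))
    (hs : ∀ i, Nonempty (s i ≫ p ≅ 𝟙 (ofMet X.obj))) :
    ∃ (c : ofMet X.obj ⟶ GH.{u} n) (d : P ⟶ GH (n + 1)),
      (∀ i, ∃ α : c ≫ repeatSection.{u} n i ≅ s i ≫ d, IsTwoCartesian α) ∧
      ∃ β : d ≫ forgetLast.{u} n ≅ p ≫ c, IsTwoCartesian β := by
  obtain ⟨Q, f, val, hf, hfull, hfaith, hval, hp⟩ := h.exists_val
  let A : Fam n X.obj :=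
    { P := Q
      p := f
      proper := hf
      s := fun i => valAt (s i ≫ val) (ofMet.mk (𝟙 X.obj))
      p_s := fun i b => by
        obtain ⟨α⟩ := hs i
        exact (val_of_valAt hp ((s i).w_obj (ofMet.mk (𝟙 X.obj))) b).symm.trans
          (valAt_congr α (ofMet.mk (𝟙 X.obj)) b) }
  exact ⟨cls A, val ≫ cls A.diag, fun i => exists_isTwoCartesian_repeatSection (A := A) val hfull
    hfaith p hp i (s i) fun g t => valAt_eq (s i ≫ val) g t,
    exists_isTwoCartesian_forgetLast (A := A) val hfull hfaith hval p hp _ (Ev.cls A)⟩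

end Squares


/-! ## Rich embeddings into a universal space -/

/-- The index set of the coordinates of the ambient space. -/
abbrev Coord : Type u := ULift.{u} (ℕ → (ℕ → ℝ) → ℝ)

/-- The ambient space: bounded functions on the set of coordinates. -/
abbrev Ambient : Type u := lp (fun _ : Coord.{u} => ℝ) ⊤

/-- Up to a constant, every 1-Lipschitz function is given by as many coordinates as possible. -/
def IsRich {Y : Type u} [MetricSpace Y] (j : Y → Ambient.{u}) : Prop :=
  ∀ ψ : Y → ℝ, LipschitzWith 1 ψ → ∃ (c : ℝ) (e : Coord.{u} → Coord.{u}), Function.Injective e ∧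
    ∀ m y, j y (e m) = ψ y + c

section Rich

variable {Y Y₀ : Type u} [MetricSpace Y] [MetricSpace Y₀]

/-- McShane's extension theorem, applied on the range of `i`. -/
lemma exists_extend_lipschitz {i : Y₀ → Y} (hi : Isometry i) {ψ : Y₀ → ℝ}
    (hψ : LipschitzWith 1 ψ) : ∃ φ : Y → ℝ, LipschitzWith 1 φ ∧ ∀ y, φ (i y) = ψ y := by
  have h : LipschitzOnWith 1 (Function.extend i ψ 0) (Set.range i) := by
    rintro _ ⟨x, rfl⟩ _ ⟨y, rfl⟩
    rw [hi.injective.extend_apply, hi.injective.extend_apply, hi.edist_eq]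
    exact hψ x y
  obtain ⟨φ, hφ, hφ'⟩ := h.extend_real
  exact ⟨φ, hφ, fun y => (hφ' ⟨y, rfl⟩).symm.trans (hi.injective.extend_apply _ _ _)⟩

/-- A 1-Lipschitz function on `Y₀` extends to `Y`, and the coordinates representing the extension
represent the function. -/
lemma IsRich.comp {j : Y → Ambient.{u}} (h : IsRich j) {i : Y₀ → Y} (hi : Isometry i) :
    IsRich (j ∘ i) := by
  intro ψ hψ
  obtain ⟨φ, hφ, e⟩ := exists_extend_lipschitz hi hψ
  obtain ⟨c, e', he, h'⟩ := h φ hφ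
  exact ⟨c, e', he, fun m y => by rw [Function.comp_apply, h', e]⟩

/-- Every coordinate of `j₀` must be extended to `Y` so that all 1-Lipschitz `ψ` occur. Richness of
`j₀` leaves room: the restriction of `ψ`, shifted by some `c`, fills a whole copy of `Coord`, whose
members can be assigned all the required extensions. -/
theorem IsRich.exists_extend_of_injective [Nonempty Y₀] {i : Y₀ → Y} (hi : Isometry i)
    {j₀ : Y₀ → Ambient.{u}} (hj₀ : Isometry j₀) (h : IsRich j₀)
    {ι : Y → ℕ → ℝ} (hι : Function.Injective ι) :
    ∃ j : Y → Ambient.{u}, Isometry j ∧ IsRich j ∧ ∀ y, j (i y) = j₀ y := by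
  classical
  obtain ⟨y₀⟩ := ‹Nonempty Y₀›
  -- An index codes a function on `Y` by its zeroth entry, read through `ι`; the other entries are
  -- free.
  let σ : Coord.{u} → Y → ℝ := fun m y => m.down 0 (ι y)
  let res : Coord.{u} → Y₀ → ℝ := fun k y => j₀ y k
  have hres : ∀ k, LipschitzWith 1 (res k) := fun k => LipschitzWith.of_dist_le_mul fun x y => by
    rw [NNReal.coe_one, one_mul, ← hj₀.dist_eq, dist_eq_norm, dist_eq_norm]
    exact lp.norm_apply_le_norm ENNReal.top_ne_zero (j₀ x - j₀ y) k
  -- `E ρ` enumerates a copy of `Coord` among the coordinates restricting to `ρ`, if there is one;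
  -- otherwise it is the identity as a default value.
  have hE : ∀ ρ : Y₀ → ℝ, ∃ e : Coord.{u} → Coord.{u}, Function.Injective e ∧
      ((∃ e' : Coord.{u} → Coord.{u}, Function.Injective e' ∧ ∀ m, res (e' m) = ρ) →
        ∀ m, res (e m) = ρ) := fun ρ => by
    by_cases H : ∃ e' : Coord.{u} → Coord.{u}, Function.Injective e' ∧ ∀ m, res (e' m) = ρ
    · obtain ⟨e, he, he'⟩ := H
      exact ⟨e, he, fun _ => he'⟩
    · exact ⟨id, Function.injective_id, fun H' => absurd H' H⟩
  choose E hE hE' using hE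
  -- If `k` is number `m` in the copy for its own restriction and `m` codes an admissible extension,
  -- that one is taken; otherwise any extension will do. Injectivity of `E` makes `m` unique.
  have hF : ∀ k, ∃ φ : Y → ℝ, LipschitzWith 1 φ ∧ (∀ y, φ (i y) = res k y) ∧
      ∀ m, E (res k) m = k → LipschitzWith 1 (σ m) → (∀ y, σ m (i y) = res k y) → φ = σ m := by
    intro k
    by_cases H : ∃ m, E (res k) m = k ∧ LipschitzWith 1 (σ m) ∧ ∀ y, σ m (i y) = res k y
    · obtain ⟨m, h₁, h₂, h₃⟩ := H
      exact ⟨σ m, h₂, h₃, fun m' h' _ _ => congrArg σ (hE _ (h₁.trans h'.symm))⟩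
    · obtain ⟨φ, h₁, h₂⟩ := exists_extend_lipschitz hi (hres k)
      exact ⟨φ, h₁, h₂, fun m a b c => absurd ⟨m, a, b, c⟩ H⟩
  choose F hF₁ hF₂ hF₃ using hF
  have hd : ∀ k x y, |F k x - F k y| ≤ dist x y := fun k x y => by
    simpa [Real.dist_eq] using (hF₁ k).dist_le_mul x y
  have hb : ∀ y, Memℓp (fun k => F k y) ⊤ := fun y => by
    -- At `i y₀` the coordinates are those of `j₀ y₀`, hence bounded; the Lipschitz condition
    -- carries the bound to `y`, uniformly in `k`.
    refine memℓp_infty ⟨‖j₀ y₀‖ + dist y (i y₀), ?_⟩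
    rintro _ ⟨k, rfl⟩
    have h₁ : ‖F k (i y₀)‖ ≤ ‖j₀ y₀‖ := by
      rw [hF₂]
      exact lp.norm_apply_le_norm ENNReal.top_ne_zero (j₀ y₀) k
    have h₂ := norm_add_le (F k (i y₀)) (F k y - F k (i y₀))
    rw [add_sub_cancel] at h₂
    exact h₂.trans (add_le_add h₁ (hd k y (i y₀)))
  let j : Y → Ambient.{u} := fun y => ⟨fun k => F k y, hb y⟩
  have hr : IsRich j := by
    intro ψ hψ
    obtain ⟨c, e, he, he'⟩ := h (fun y => ψ (i y)) fun x y => by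
      rw [← hi.edist_eq]
      exact hψ _ _
    -- Entry zero codes `ψ + c` and the later entries store `m`, so one function has as many codes
    -- as `Coord` has elements.
    let D : Coord.{u} → Coord.{u} := fun m =>
      ⟨fun k => Nat.casesOn k (Function.extend ι (fun y => ψ y + c) 0) m.down⟩
    have hD : Function.Injective D := fun m m' hm => by
      refine ULift.ext _ _ (funext fun k => ?_)
      exact congrArg (fun q : Coord.{u} => q.down (k + 1)) hm
    have hσ : ∀ m, σ (D m) = fun y => ψ y + c := fun m => funext fun y =>
      hι.extend_apply (fun y => ψ y + c) 0 y
    have hk : ∀ m, res (E (fun y => ψ (i y) + c) m) = fun y => ψ (i y) + c :=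
      hE' _ ⟨e, he, fun m => funext fun y => he' m y⟩
    refine ⟨c, fun m => E (fun y => ψ (i y) + c) (D m), (hE _).comp hD, fun m y => ?_⟩
    refine (congrFun (hF₃ _ (D m) ?_ ?_ ?_) y).trans (congrFun (hσ m) y)
    · rw [hk]
    · rw [hσ]
      refine fun x y => ?_
      rw [edist_add_right]
      exact hψ x y
    · rw [hk, hσ]
      exact fun _ => rfl
  refine ⟨j, Isometry.of_dist_eq fun x y => le_antisymm ?_ ?_, hr, fun y => ?_⟩
  · rw [dist_eq_norm]
    exact lp.norm_le_of_forall_le dist_nonneg fun k => hd k x y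
  -- A coordinate equal to the distance from `y` up to a constant attains `dist x y`.
  · obtain ⟨c, e, -, he⟩ := hr (fun z => dist z y) (LipschitzWith.dist_left y)
    have h₁ := lp.norm_apply_le_norm ENNReal.top_ne_zero (j x - j y) (e ⟨0⟩)
    rw [← dist_eq_norm] at h₁
    refine le_trans ?_ h₁
    have h₂ : (j x - j y) (e ⟨0⟩) = dist x y := by
      change j x (e ⟨0⟩) - j y (e ⟨0⟩) = _
      rw [he, he, dist_self]
      ring
    rw [h₂]
    exact le_abs_self _
  · exact lp.ext (funext fun k => hF₂ k y)

/-- Rich embeddings extend to separable spaces. -/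
theorem IsRich.exists_extend [Nonempty Y₀] [TopologicalSpace.SeparableSpace Y] {i : Y₀ → Y}
    (hi : Isometry i) {j₀ : Y₀ → Ambient.{u}} (hj₀ : Isometry j₀) (h : IsRich j₀) :
    ∃ j : Y → Ambient.{u}, Isometry j ∧ IsRich j ∧ ∀ y, j (i y) = j₀ y := by
  obtain ⟨κ, hκ⟩ := KuratowskiEmbedding.exists_isometric_embedding Y
  exact h.exists_extend_of_injective hi hj₀ (ι := fun y => κ y) fun x y h =>
    hκ.injective (lp.ext h)

/-- Every separable metric space has a rich embedding. -/
theorem exists_isRich [TopologicalSpace.SeparableSpace Y] :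
    ∃ j : Y → Ambient.{u}, Isometry j ∧ IsRich j := by
  rcases isEmpty_or_nonempty Y with hY | ⟨⟨y⟩⟩
  · exact ⟨fun _ => 0, fun x => hY.elim x, fun _ _ => ⟨0, id, Function.injective_id, fun _ y =>
      hY.elim y⟩⟩
  -- The extension starts from one point sent to zero, which is rich because the constant `c` can
  -- cancel the value of `ψ`.
  · obtain ⟨j, h₁, h₂, -⟩ := IsRich.exists_extend (Y₀ := PUnit.{u + 1}) (i := fun _ => y)
      (j₀ := fun _ => 0) isometry_subsingleton isometry_subsingleton
      (fun ψ _ => ⟨-ψ PUnit.unit, id, Function.injective_id, fun m y => (add_neg_cancel _).symm⟩)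
    exact ⟨j, h₁, h₂⟩

end Rich


open TopologicalSpace

/-! ## The universal family -/

lemma IsRich.subtype_val {Y : Type u} [MetricSpace Y] {j : Y → Ambient.{u}} (h : IsRich j)
    (hj : Isometry j) {S : Set Ambient.{u}} (hS : S ⊆ Set.range j) :
    IsRich (Subtype.val : S → Ambient.{u}) := by
  choose κ hκ using fun x : S => hS x.2
  have e : j ∘ κ = Subtype.val := funext hκ
  rw [← e]
  refine h.comp fun x y => ?_
  rw [← hj.edist_eq, hκ, hκ]
  rfl

/-- The moduli space of rich compact subspaces of the ambient space with `n` points. -/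
noncomputable def Moduli (n : ℕ) : Met.{u} :=
  ⟨{x : NonemptyCompacts Ambient.{u} × (Fin n → Ambient.{u}) // (∀ i, x.2 i ∈ x.1) ∧
    IsRich (Subtype.val : (x.1 : Set Ambient.{u}) → Ambient.{u})}⟩

namespace Moduli

variable {n : ℕ}

/-- The compact set. -/
def carrierSet (x : Moduli.{u} n) : Set Ambient.{u} := (Subtype.val x).1

/-- The marked points. -/
def mark (x : Moduli.{u} n) : Fin n → Ambient.{u} := (Subtype.val x).2

lemma isCompact_set (x : Moduli.{u} n) : IsCompact (carrierSet x) := (Subtype.val x).1.isCompact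

lemma nonempty_set (x : Moduli.{u} n) : (carrierSet x).Nonempty := (Subtype.val x).1.nonempty

lemma mark_mem (x : Moduli.{u} n) (i : Fin n) : mark x i ∈ carrierSet x := x.2.1 i

lemma isRich_set (x : Moduli.{u} n) : IsRich (Subtype.val : carrierSet x → Ambient.{u}) := x.2.2

lemma dist_le {x y : Moduli.{u} n} {r : ℝ}
    (h : Metric.hausdorffDist (carrierSet x) (carrierSet y) ≤ r)
    (hm : ∀ i, dist (mark x i) (mark y i) ≤ r) : dist x y ≤ r :=
  max_le h ((dist_pi_le_iff (Metric.hausdorffDist_nonneg.trans h)).2 hm)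

lemma hausdorffDist_le (x y : Moduli.{u} n) :
    Metric.hausdorffDist (carrierSet x) (carrierSet y) ≤ dist x y :=
  le_max_left _ _

lemma dist_mark_le (x y : Moduli.{u} n) (i : Fin n) : dist (mark x i) (mark y i) ≤ dist x y :=
  (dist_le_pi_dist x.1.2 y.1.2 i).trans (le_max_right _ _)

lemma ext {x y : Moduli.{u} n} (h : carrierSet x = carrierSet y)
    (hm : ∀ i, mark x i = mark y i) : x = y :=
  Subtype.ext (Prod.ext (NonemptyCompacts.ext h) (funext hm))

lemma hausdorffEDist_ne_top (x y : Moduli.{u} n) :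
    Metric.hausdorffEDist (carrierSet x) (carrierSet y) ≠ ⊤ :=
  Metric.hausdorffEDist_ne_top_of_nonempty_of_bounded (nonempty_set x) (nonempty_set y)
    (isCompact_set x).isBounded (isCompact_set y).isBounded

end Moduli

/-- The total space of the universal family. -/
noncomputable def ModuliTotal (n : ℕ) : Met.{u} :=
  ⟨{q : Moduli.{u} n × Ambient.{u} // q.2 ∈ Moduli.carrierSet q.1}⟩

/-- The projection of the universal family. -/
noncomputable def moduliProj (n : ℕ) : ModuliTotal.{u} n ⟶ Moduli.{u} n :=
  Met.mkHom (fun q => Subtype.val q |>.1) fun _ _ => le_max_left _ _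

/-- The point of the ambient space given by a point of the universal family. -/
def moduliPoint {n : ℕ} (q : ModuliTotal.{u} n) : Ambient.{u} := (Subtype.val q).2

lemma dist_moduliTotal {n : ℕ} (q q' : ModuliTotal.{u} n) : dist q q' =
    max (dist (moduliProj n q) (moduliProj n q')) (dist (moduliPoint q) (moduliPoint q')) := rfl

lemma moduliTotal_ext {n : ℕ} {q q' : ModuliTotal.{u} n} (h : moduliProj n q = moduliProj n q')
    (h' : moduliPoint q = moduliPoint q') : q = q' := Subtype.ext (Prod.ext h h')

/-- The metric of the moduli space dominates the Hausdorff distance, so a nearest point in the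
compact set is a lift. -/
lemma isProperSubmetry_moduliProj (n : ℕ) : IsProperSubmetry (moduliProj.{u} n) := by
  refine isProperSubmetry_of (fun x => ?_) (fun x => ?_) fun q x ε hε => ?_
  · obtain ⟨e, he⟩ := Moduli.nonempty_set x
    exact ⟨⟨(x, e), he⟩, rfl⟩
  · have : CompactSpace (Moduli.carrierSet x) :=
      isCompact_iff_compactSpace.1 (Moduli.isCompact_set x)
    let κ : Moduli.carrierSet x → ModuliTotal.{u} n := fun e => ⟨(x, e.1), e.2⟩
    have hκ : Continuous κ :=
      (continuous_const.prodMk continuous_subtype_val).subtype_mk _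
    convert isCompact_range hκ
    ext q
    constructor
    · rintro rfl
      exact ⟨⟨q.1.2, q.2⟩, rfl⟩
    · rintro ⟨e, rfl⟩
      rfl
  · obtain ⟨e, he, he'⟩ := (Moduli.isCompact_set x).exists_infDist_eq_dist
      (Moduli.nonempty_set x) (moduliPoint q)
    have h : dist (moduliPoint q) e ≤ dist (moduliProj n q) x := by
      rw [← he']
      exact (Metric.infDist_le_hausdorffDist_of_mem q.2
        (Moduli.hausdorffEDist_ne_top _ _)).trans (Moduli.hausdorffDist_le _ _)
    exact ⟨⟨(x, e), he⟩, rfl, (max_le le_rfl h).trans (le_add_of_nonneg_right hε.le)⟩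

/-- The universal family. -/
noncomputable def moduliFam (n : ℕ) : Fam n (Moduli.{u} n) where
  P := ModuliTotal n
  p := moduliProj n
  proper := isProperSubmetry_moduliProj n
  s i := Met.mkHom (fun x => ⟨(x, Moduli.mark x i), Moduli.mark_mem x i⟩) fun x y =>
    max_le le_rfl (Moduli.dist_mark_le x y i)
  p_s _ _ := rfl

/-- A rich embedding of the total space gives a classifying map. -/
theorem Fam.exists_isCart_moduliFam {n : ℕ} {B : Met.{u}} (A : Fam n B) {j : A.P → Ambient.{u}}
    (hj : Isometry j) (hr : IsRich j) : ∃ (h : B ⟶ Moduli.{u} n) (t : A.P ⟶ ModuliTotal n),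
      A.IsCart (moduliFam n) t h ∧ (∀ q, moduliPoint (t q) = j q) ∧
      (∀ b, Moduli.carrierSet (h b) = j '' (A.p ⁻¹' {b})) ∧
      ∀ b i, Moduli.mark (h b) i = j (A.s i b) := by
  let h₀ : B → Moduli.{u} n := fun b =>
    ⟨(⟨⟨j '' (A.p ⁻¹' {b}), (A.proper.isCompact_fiber b).image hj.continuous⟩,
      Set.Nonempty.image j (A.proper.1.1 b)⟩, fun i => j (A.s i b)), fun i => ⟨_, A.p_s i b, rfl⟩,
      hr.subtype_val hj (Set.image_subset_range _ _)⟩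
  let h : B ⟶ Moduli.{u} n := Met.mkHom h₀ fun b b' => by
    refine Moduli.dist_le ?_ fun i => ?_
    -- For the compact sets, the Lipschitz condition is the submetry inequality of `A.p`, preserved
    -- by the isometry `j`.
    · change Metric.hausdorffDist (j '' _) (j '' _) ≤ _
      rw [Metric.hausdorffDist_image hj]
      have := A.proper.1.2 b b'
      rw [edist_dist] at this
      exact ENNReal.toReal_le_of_le_ofReal dist_nonneg this
    · exact (hj.dist_eq _ _).trans_le (Met.dist_map_le _ _ _)
  let t : A.P ⟶ ModuliTotal n := Met.mkHom (fun q => ⟨(h (A.p q), j q), ⟨q, rfl, rfl⟩⟩) fun q q' =>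
    max_le ((Met.dist_map_le h _ _).trans (Met.dist_map_le A.p _ _)) (hj.dist_eq q q').le
  refine ⟨h, t, ⟨fun _ => rfl, fun x y => ?_, ?_, fun i b => ?_⟩, fun _ => rfl, fun _ => rfl,
    fun _ _ => rfl⟩
  · refine le_trans ?_ (le_max_left _ _)
    exact (hj.dist_eq x y).symm.le.trans (le_max_right _ _)
  · rintro ⟨⟨_, e⟩, he⟩ b rfl
    obtain ⟨q, hq, hq'⟩ := he
    exact ⟨q, moduliTotal_ext (congrArg h hq) hq', hq⟩
  · exact moduliTotal_ext (congrArg h (A.p_s i b)) rfl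

/-- The fibres over a countable dense set are compact, hence separable, and exact lifting makes
their union dense. -/
lemma IsProperSubmetry.separableSpace {X B : Met.{u}} {f : X ⟶ B} (h : IsProperSubmetry f)
    (hB : SeparableSpace B) : SeparableSpace X := by
  refine isSeparable_univ_iff.1 ?_
  obtain ⟨D, hD, hD'⟩ := exists_countable_dense B
  have := hD.to_subtype
  have h₁ : IsSeparable (⋃ b : D, f ⁻¹' {b.1}) :=
    IsSeparable.iUnion fun b => (h.isCompact_fiber b.1).isSeparable
  refine h₁.closure.mono fun x _ => Metric.mem_closure_iff.2 fun ε hε => ?_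
  obtain ⟨b, hb, hb'⟩ := hD'.exists_dist_lt (f x) hε
  obtain ⟨x', hx', h'⟩ := h.exists_lift x b
  exact ⟨x', Set.mem_iUnion.2 ⟨⟨b, hb⟩, hx'⟩, h'.trans_lt hb'⟩

lemma TBMet.separableSpace (T : TBMet.{u}) : SeparableSpace T.obj :=
  isSeparable_univ_iff.1 T.property.isSeparable


open GH TopologicalSpace

variable {n : ℕ}

/-! ## The classifying morphism of the universal family -/

lemma Fam.IsCart.isometry {B B' : Met.{u}} [Subsingleton B] {A : Fam n B} {A' : Fam n B'}
    {t : A.P ⟶ A'.P} {g : B ⟶ B'} (h : A.IsCart A' t g) : Isometry t.toFun :=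
  Isometry.of_dist_eq fun x y => le_antisymm (Met.dist_map_le t x y) <|
    (h.dist_le x y).trans (max_le le_rfl (by
      rw [Subsingleton.elim (A.p x) (A.p y), dist_self]
      exact dist_nonneg))

instance : Subsingleton pt.{u}.obj := inferInstanceAs (Subsingleton PUnit)

/-- An identification of a fibre with a fibre of the universal family extends to a classifying
map. -/
theorem Fam.exists_isCart_moduliFam_of_fiber {B : Met.{u}} {D : Fam n pt.{u}.obj} {Q : Fam n B}
    {a : D.P ⟶ Q.P} {f : pt.{u}.obj ⟶ B} (ha : D.IsCart Q a f) {b : D.P ⟶ ModuliTotal.{u} n}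
    {g : pt.{u}.obj ⟶ Moduli.{u} n} (hb : D.IsCart (moduliFam n) b g)
    (hQ : SeparableSpace Q.P) : ∃ (h : B ⟶ Moduli.{u} n) (t : Q.P ⟶ ModuliTotal.{u} n),
      Q.IsCart (moduliFam n) t h ∧ (∀ z, t (a z) = b z) ∧ ∀ o, h (f o) = g o := by
  let o : pt.{u}.obj := PUnit.unit
  have hD : ∀ z, D.p z = o := fun z => Subsingleton.elim _ _
  have hbo : ∀ z, moduliProj n (b z) = g o := fun z => (hb.comm z).trans (congrArg g (hD z))
  have hmem : ∀ z, moduliPoint (b z) ∈ Moduli.carrierSet (g o) := fun z => hbo z ▸ (b z).2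
  let κ : D.P → Moduli.carrierSet (g o) := fun z => ⟨moduliPoint (b z), hmem z⟩
  have hκ : Isometry κ := Isometry.of_dist_eq fun z z' => by
    refine Eq.trans ?_ (hb.isometry.dist_eq z z')
    refine Eq.trans ?_ (dist_moduliTotal _ _).symm
    rw [hbo, hbo, dist_self]
    exact (max_eq_right dist_nonneg).symm
  obtain ⟨z₀, -⟩ := D.proper.1.1 o
  have : Nonempty D.P := ⟨z₀⟩
  -- The fibre already lies richly in the ambient space. Extending this embedding to `Q.P` makes the
  -- new classifying map take the prescribed value at `f o`.
  obtain ⟨j, hj, hr, hja⟩ := ((Moduli.isRich_set (g o)).comp hκ).exists_extend ha.isometry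
    (isometry_subtype_coe.comp hκ)
  obtain ⟨h, t, ht, htj, hset, hmark⟩ := Q.exists_isCart_moduliFam hj hr
  have ho : h (f o) = g o := by
    refine Moduli.ext ?_ fun i => ?_
    · rw [hset]
      refine Set.Subset.antisymm ?_ fun e he => ?_
      · rintro _ ⟨q, hq, rfl⟩
        obtain ⟨z, rfl, -⟩ := ha.exists_lift q o hq
        rw [hja]
        exact hmem z
      · obtain ⟨z, hz, -⟩ := hb.exists_lift ⟨(g o, e), he⟩ o rfl
        refine ⟨a z, (ha.comm z).trans (congrArg f (hD z)), (hja z).trans ?_⟩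
        exact congrArg moduliPoint hz
    · rw [hmark, ← ha.sec, hja]
      exact congrArg moduliPoint (hb.sec i o)
  refine ⟨h, t, ht, fun z => moduliTotal_ext ?_ ((htj _).trans (hja z)), fun o' => ?_⟩
  · refine (ht.comm _).trans ?_
    rw [ha.comm, hbo, hD]
    exact ho
  · rw [Subsingleton.elim o' o]
    exact ho

section

variable {𝒲 : BasedCategory.{u, u + 1} TBMet.{u}} {B : Met.{u}} {F G : 𝒲 ⟶ GH.{u} n} {A : Fam n B}
  {k : ∀ w, (𝒲.p.obj w).obj ⟶ B}

/-- Transport along an isomorphism. -/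
def Ev.ofIso (α : F ≅ G) (E : Ev G A k) : Ev F A k where
  ev w := tot (x := F.obj w) (y := G.obj w) (α.hom.app w) ≫ E.ev w
  cart w := (isCart_of_isHomLift (b := 𝟙 (𝒲.p.obj w)) (F.w_obj w) (G.w_obj w) (α.hom.app w)
    (α.hom.isHomLift' w)).comp (E.cart w)
  nat {_ w'} φ q := (congrArg (E.ev w') (Met.congr (congrArg tot (α.hom.naturality φ)) q)).trans
    (E.nat φ _)

end

/-- Every object of `GH_n` is classified by a map to the moduli space. -/
theorem essImage_fiberMap_cls (T : TBMet.{u}) (x : Fiber (GH.{u} n).p T) :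
    (fiberMap (cls (moduliFam.{u} n)) T).essImage x := by
  let A : Fam n T.obj := fam x.1 x.2
  have hA : SeparableSpace A.P := A.proper.separableSpace T.separableSpace
  obtain ⟨j, hj, hr⟩ := exists_isRich (Y := A.P)
  obtain ⟨h, t, ht, -⟩ := A.exists_isCart_moduliFam hj hr
  let y : Fiber (ofMet (Moduli.{u} n)).p T := ⟨ofMet.mk h, rfl⟩
  obtain ⟨q, hq, -⟩ := ((Ev.cls (moduliFam.{u} n)).cart (ofMet.mk h)).exists_factor ht
    (k := 𝟙 T.obj) fun _ => rfl
  obtain ⟨φ, hφ, -⟩ := exists_hom_of_isCart (b := 𝟙 T) (y := (cls (moduliFam.{u} n)).obj y.1)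
    x.2 rfl hq
  let ψ : x ⟶ (fiberMap (cls (moduliFam.{u} n)) T).obj y := ⟨φ, hφ⟩
  have := ((isFiberedInGroupoids_GH.{u} n).2 T).all_isIso ψ
  exact ⟨y, ⟨(asIso ψ).symm⟩⟩

/-- A lifting problem is a family over `2_s` whose fibre over zero is identified with a fibre of the
universal family. Extending the embedding of that fibre gives a map from `2_s` itself to the moduli
space, and the lift over `2_r` is its composite with `2_r → 2_s`. -/
theorem isFormalSubmetry_cls_moduliFam (n : ℕ) : IsFormalSubmetry (cls (moduliFam.{u} n)) := by
  refine ⟨⟨fun x => essImage_fiberMap_cls pt x⟩, fun r s hs hrs x g α => ?_⟩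
  let w₀ : (ofMet pt.{u}.obj).obj := ofMet.mk (𝟙 pt.{u}.obj)
  let Eg := Ev.ofId g
  let E₁ := Ev.ofIso α (Eg.precomp (ofMetMap (iotaZero s hs).hom))
  let Ex := (Ev.cls (moduliFam.{u} n)).precomp x
  obtain ⟨h, t, ht, ht₀, hh⟩ := Fam.exists_isCart_moduliFam_of_fiber (E₁.cart w₀) (Ex.cart w₀)
    ((fam (g.obj (ofMet.mk (𝟙 _))) (g.w_obj _)).proper.separableSpace (two s hs).separableSpace)
  have hE : ∀ w z, t (E₁.ev w z) = Ex.ev w z := fun w z => by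
    refine (congrArg t (E₁.nat (ofMet.toId w) z).symm).trans ((ht₀ _).trans ?_)
    exact Ex.nat (ofMet.toId w) z
  let K := ofMetMap (iotaTwo.{u} r s (hs.trans hrs) hs hrs.le).hom
  obtain ⟨γ, hγ⟩ := ((Ev.cls (moduliFam.{u} n)).precomp (K ≫ ofMetMap h)).exists_iso
    ((Eg.precomp K).postcomp ht) fun _ _ => rfl
  obtain ⟨β⟩ : Nonempty (ofMetMap (iotaZero r (hs.trans hrs)).hom ≫ (K ≫ ofMetMap h) ≅ x) :=
    exists_iso_of_valAt fun w o => by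
      rw [valAt_eq x]
      exact hh _
  refine ⟨K ≫ ofMetMap h, β, γ, BasedNatTrans.ext _ _ (NatTrans.ext (funext fun w => ?_))⟩
  let S := (ofMet pt.{u}.obj).p.obj w
  let V := cls (moduliFam.{u} n)
  let w' := (ofMetMap (iotaZero r (hs.trans hrs)).hom).obj w
  let φ₁ : (K ≫ ofMetMap h ≫ V).obj w' ⟶ (x ≫ V).obj w := V.map (β.hom.app w)
  let φ₂ : (x ≫ V).obj w ⟶ (K ≫ g).obj w' := α.hom.app w
  let φ₃ : (K ≫ ofMetMap h ≫ V).obj w' ⟶ (K ≫ g).obj w' := γ.hom.app w'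
  have l₁ : (GH n).p.IsHomLift (𝟙 S) φ₁ := by
    have := β.hom.isHomLift' w
    exact BasedFunctor.preserves_isHomLift V (𝟙 S) (β.hom.app w)
  have l₂ : (GH n).p.IsHomLift (𝟙 S) φ₂ := α.hom.isHomLift' w
  have l₃ : (GH n).p.IsHomLift (𝟙 S) φ₃ := γ.hom.isHomLift' w'
  have l₁₂ : (GH n).p.IsHomLift (𝟙 S) (φ₁ ≫ φ₂) :=
    @IsHomLift.comp_of_lift_id _ _ _ _ (GH n).p S _ _ _ _ _ l₁ l₂
  change φ₁ ≫ φ₂ = φ₃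
  refine hom_ext_of_isHomLift l₁₂ l₃ fun q => ?_
  -- Two points are equal if they agree in the universal family, by `hE` and the formula for `γ`,
  -- and in the base.
  refine (((Eg.precomp K).cart w').comp ht).eq_of ?_ ?_
  · refine (hE w (tot φ₁ q)).trans (Eq.trans ?_ (hγ w' q).symm)
    exact (Ev.cls (moduliFam.{u} n)).nat (β.hom.app w) q
  · refine Eq.trans ?_ ((isCart_of_isHomLift ((K ≫ ofMetMap h ≫ V).w_obj w') ((K ≫ g).w_obj w') φ₃
      l₃).comm q).symm
    exact (isCart_of_isHomLift ((K ≫ ofMetMap h ≫ V).w_obj w') ((K ≫ g).w_obj w') (φ₁ ≫ φ₂)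
      l₁₂).comm q

/-- The identity covering suffices: a total space over a totally bounded `T` is separable, so it
embeds richly as a whole and is classified by a map defined on all of `T`. -/
theorem isOfQuotientType_GH (n : ℕ) : IsOfQuotientType (GH.{u} n) := by
  refine ⟨_, cls (moduliFam.{u} n), isFormalSubmetry_cls_moduliFam n, fun T x =>
    ⟨PUnit, fun _ => T, fun _ => 𝟙 T, ⟨fun _ _ => ⟨1, one_pos, fun _ _ _ _ _ => Set.image_id _⟩,
      fun x₁ x₂ x₃ ε hε => ⟨PUnit.unit, x₁, x₂, x₃, rfl, rfl, rfl, by simpa, by simpa⟩⟩, fun _ =>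
      ⟨x, 𝟙 x.1, ?_, essImage_fiberMap_cls T x⟩⟩⟩
  have := (allCartesian_GH n).isStronglyCartesian (𝟙 T) (𝟙 x.1) (IsHomLift.id x.2)
  infer_instance

end MetStack

theorem mainTheorem5 :
    -- the forgetful morphisms are representable proper submetries
    (∀ n : ℕ, IsRepresentableProperSubmetry (forgetLast.{u} n)) ∧
    -- every `GH_n` is a naive metric stack of quotient type
    (∀ n : ℕ, IsNaiveMetricStack (GH.{u} n) ∧ IsOfQuotientType (GH.{u} n)) ∧
    -- a family with `n` sections is pulled back from the forgetful morphism, and its sections are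
    -- pulled back from the morphisms which repeat a section
    (∀ (n : ℕ) (X : TBMet.{u}) (P : BasedCategory.{u, u + 1} TBMet.{u}) (p : P ⟶ ofMet X.obj)
      (s : Fin n → (ofMet X.obj ⟶ P)),
      IsStackInGroupoids P → IsRepresentableProperSubmetry p →
      (∀ i, Nonempty (s i ≫ p ≅ 𝟙 (ofMet X.obj))) →
      ∃ (cls : ofMet X.obj ⟶ GH.{u} n) (diag : P ⟶ GH.{u} (n + 1)),
        (∀ i, ∃ α : cls ≫ repeatSection.{u} n i ≅ s i ≫ diag, IsTwoCartesian α) ∧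
        ∃ β : diag ≫ forgetLast.{u} n ≅ p ≫ cls, IsTwoCartesian β) :=
  ⟨isRepresentableProperSubmetry_forgetLast, fun n => ⟨⟨isStackInGroupoids_GH n, _, _,
    isFormalSubmetry_cls_moduliFam n⟩, isOfQuotientType_GH n⟩, fun _ _ _ _ s _ hp hs =>
      exists_classifying hp s hs⟩
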